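/- Let $m,n\in\mathbb N_0$, $R,L\in(0,\infty)$, $\alpha\in(0,1]$ and $\varepsilon\in(0,1/100)$. \textbf{Definitions.} For $d>0$ let $\mathscr C^{1,\alpha}_{m,n}(R,L,d)$ be the class of compact $m$-dimensional embedded $C^{1,\alpha}$-submanifolds $\Sigma$ of $\mathbb R^n$ (without boundary, not necessarily connected) such that $\Sigma\subset\overline{\mathbb B}^n(0,d)$ and for each $x\in\Sigma$ there is a $C^{1,\alpha}$ function $f_x:T_x\Sigma\to T_x\Sigma^\perp$ with $\Sigma\cap\mathbb B^n(x,R)=(x+\mathrm{graph}(f_x))\cap\mathbb B^n(x,R)$, $f_x(0)=0$, $Df_x(0)=0$, $\|Df_x(\xi)-Df_x(\eta)\|\le L|\xi-\eta|^\alpha$ for all $\xi,\eta\in T_x\Sigma$, and $\mathrm{lip}(f_x)\le 1$. An \emph{$\varepsilon$-normal map} for $\Sigma$ is a Lipschitz $C^1$ map $\Phi$ from $\Sigma$ to the set of orthogonal projections of $\mathbb R^n$ of trace $n-m$ such that $\|\Phi(x)-P_{(T_x\Sigma)^\perp}\|\le\varepsilon$ for all $x\in\Sigma$, where $P_V$ denotes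 the orthogonal projection onto $V$ and $\|\cdot\|$ the operator norm. For $\delta>0$ put $N_\delta(\Sigma,\Phi)=\{(a,v)\in\Sigma\times\mathbb R^n:\Phi(a)v=v,\ |v|<\delta\}$. Let $d_{\mathcal H}(E,F)=\sup_{y\in E}\mathrm{dist}(y,F)+\sup_{z\in F}\mathrm{dist}(z,E)$. A \emph{$C^1$-ambient isotopy} between $\Sigma_1$ and $\Sigma_2$ is a $C^1$ map $H:\mathbb R^n\times[0,1]\to\mathbb R^n$ such that every $H(\cdot,t)$ is a $C^1$-diffeomorphism of $\mathbb R^n$ onto itself, $H(x,1)=x$ for all $x\in\mathbb R^n$, and $H(\Sigma_2\times\{0\})=\Sigma_1$. For $\Lambda>0$ put \[ \delta_{tub}(\Lambda)=\min\Big\{\tfrac R4,\ \tfrac14\big(\tfrac{\varepsilon}{L}\big)^{1/\alpha},\ \tfrac{\varepsilon}{4\Lambda},\ 1\Big\}, \] \[ \rho_G(\Lambda)=\min\Big\{\tfrac18\delta_{tub}(\Lambda),\ (2L)^{-2/\alpha},\ 2^{-6}R^2,\ 2^{-12/\alpha}(257L+8)^{-2/\alpha},\ 2^{-9}\Lambda^{-2},\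 \big(10^4(\Lambda+1)(L+1)\big)^{-2/\alpha}\Big\}. \] \textbf{Statement.} (1) Let $d,\Lambda>0$, let $\Sigma_1,\Sigma_2\in\mathscr C^{1,\alpha}_{m,n}(R,L,d)$, and let $\Phi_1$ be an $\varepsilon$-normal map for $\Sigma_1$ with $\mathrm{lip}(\Phi_1)\le\Lambda$. If $d_{\mathcal H}(\Sigma_1,\Sigma_2)<\rho_G(\Lambda)$, then $\Sigma_1$ and $\Sigma_2$ are $C^1$-ambient isotopic. Moreover, the $C^1$-ambient isotopy $H$ can be chosen to contract $\Sigma_2$ along the fibres of the tubular neighbourhood of $\Sigma_1$ given by $\Phi_1$: each $x\in\Sigma_2$ can be written in exactly one way as $x=a+v$ with $(a,v)\in N_{\delta_{tub}(\Lambda)}(\Sigma_1,\Phi_1)$, and $H(x,t)=a+tv$ for all $t\in[0,1]$. (2) There is $\Lambda>0$ depending only on $R,L,\alpha,m,n$ and $\varepsilon$ such that for all $d>0$ and all $\Sigma_1,\Sigma_2\in\mathscr C^{1,\alpha}_{m,n}(R,L,d)$ with $d_{\mathcal H}(\Sigma_1,\Sigma_2)<\rho_G(\Lambda)$ there is an $\varepsilon$-normal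 map $\Phi_1$ for $\Sigma_1$ with $\mathrm{lip}(\Phi_1)\le\Lambda$ and a $C^1$-ambient isotopy between $\Sigma_1$ and $\Sigma_2$ as in (1). In particular (fixing $\varepsilon=1/200$) there is a threshold depending only on $R,L,\alpha,m,n$ below which $\Sigma_1$ and $\Sigma_2$ are $C^1$-ambient isotopic. -/

import Mathlib

open Set Metric Topology
open scoped NNReal ENNReal

noncomputable section

/-- Euclidean space `ℝⁿ`. -/
abbrev Euc (n : ℕ) : Type := EuclideanSpace ℝ (Fin n)

/-- The Hausdorff distance in the form `sup_{y ∈ A} dist(y,B) + sup_{z ∈ B} dist(z,A)`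
(a sum, not a maximum), with values in `[0,∞]`; it is `∞` if exactly one set is empty. -/
def hausdorffSumDist {n : ℕ} (A B : Set (Euc n)) : ℝ≥0∞ :=
  (⨆ y ∈ A, infEDist y B) + ⨆ z ∈ B, infEDist z A

/-- The translated graph `x + graph(f)` of `f : V → Vᗮ`. -/
def graphOver {n : ℕ} (x : Euc n) (V : Submodule ℝ (Euc n)) (f : V → Vᗮ) : Set (Euc n) :=
  {p | ∃ ξ : V, p = x + (ξ : Euc n) + (f ξ : Euc n)}

/-- The tangent space of `S ⊆ ℝⁿ` at `x`: the linear span of the velocities at `x` of curves that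
run in `S`. (If `S` is a `C¹` submanifold, these velocities already form a linear space.) -/
def tangentPlane {n : ℕ} (S : Set (Euc n)) (x : Euc n) : Submodule ℝ (Euc n) :=
  Submodule.span ℝ {v | ∃ γ : ℝ → Euc n,
    γ 0 = x ∧ (∀ᶠ t in 𝓝 (0 : ℝ), γ t ∈ S) ∧ HasDerivAt γ v 0}

/-- `S` is a compact `m`-dimensional embedded submanifold (without boundary) of `ℝⁿ` of class
`C^{1,α}`: it is compact and locally the graph of a `C^{1,α}` function over an `m`-plane.
Connectedness is not required. -/
def IsCompactC1HolderSubmanifold {n : ℕ} (m : ℕ) (α : ℝ) (S : Set (Euc n)) : Prop :=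
  IsCompact S ∧
    ∀ x ∈ S, ∃ V : Submodule ℝ (Euc n), Module.finrank ℝ V = m ∧
      ∃ f : V → Vᗮ, ContDiff ℝ 1 f ∧
        (∃ C : ℝ, ∀ ξ η : V, ‖fderiv ℝ f ξ - fderiv ℝ f η‖ ≤ C * ‖ξ - η‖ ^ α) ∧
        ∃ r : ℝ, 0 < r ∧ S ∩ ball x r = graphOver x V f ∩ ball x r

/-- The class `𝒞^{1,α}_{m,n}(R,L,d)` of submanifolds with controlled graph patches. -/
structure GraphPatchClass (m n : ℕ) (α R L d : ℝ) (S : Set (Euc n)) : Prop where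
  submanifold : IsCompactC1HolderSubmanifold m α S
  subset_closedBall : S ⊆ closedBall 0 d
  patches : ∀ x ∈ S, ∃ f : tangentPlane S x → (tangentPlane S x)ᗮ,
    ContDiff ℝ 1 f ∧
    S ∩ ball x R = graphOver x (tangentPlane S x) f ∩ ball x R ∧
    f 0 = 0 ∧ fderiv ℝ f 0 = 0 ∧
    (∀ ξ η : tangentPlane S x, ‖fderiv ℝ f ξ - fderiv ℝ f η‖ ≤ L * ‖ξ - η‖ ^ α) ∧
    LipschitzWith 1 f

/-- The orthogonal projections of `ℝⁿ` of trace `n - m`, i.e. those onto `(n - m)`-planes. -/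
def projectionSet (m n : ℕ) : Set (Euc n →L[ℝ] Euc n) :=
  {P | P ∘L P = P ∧ ContinuousLinearMap.adjoint P = P ∧
    LinearMap.trace ℝ (Euc n) (P : Euc n →ₗ[ℝ] Euc n) = (n : ℝ) - (m : ℝ)}

/-- `Φ` (of which only the values on `S` matter) is an `ε`-normal map for the `m`-dimensional
submanifold `S`. -/
structure IsNormalMap {n : ℕ} (m : ℕ) (ε : ℝ) (S : Set (Euc n))
    (Φ : Euc n → Euc n →L[ℝ] Euc n) : Prop where
  mapsTo : MapsTo Φ S (projectionSet m n)
  contDiffOn : ContDiffOn ℝ 1 Φ S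
  lipschitz : ∃ K : ℝ≥0, LipschitzOnWith K Φ S
  near_normal : ∀ x ∈ S, ‖Φ x - (tangentPlane S x)ᗮ.starProjection‖ ≤ ε

/-- The `δ`-normal neighbourhood `{(x,v) : x ∈ S, Φ(x)v = v, |v| < δ}`. -/
def normalNhd {n : ℕ} (δ : ℝ) (S : Set (Euc n)) (Φ : Euc n → Euc n →L[ℝ] Euc n) :
    Set (Euc n × Euc n) :=
  {p | p.1 ∈ S ∧ Φ p.1 p.2 = p.2 ∧ ‖p.2‖ < δ}

/-- The radius `δ_tub` of the tubular neighbourhood; `Λ` stands for the Lipschitz constant of the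
`ε`-normal map. -/
def deltaTub (R L α ε Λ : ℝ) : ℝ :=
  min (R / 4) (min ((ε / L) ^ (1 / α) / 4) (min (ε / (4 * Λ)) 1))

/-- `C_ang(L,A) = L (1 + (4A)²) + 2A`. -/
def cAng (L A : ℝ) : ℝ := L * (1 + (4 * A) ^ 2) + 2 * A

/-- `C_l(L,Λ) = 10⁴ (Λ + 1)(L + 1)`. -/
def cLip (L Λ : ℝ) : ℝ := 10 ^ 4 * (Λ + 1) * (L + 1)

/-- The first threshold `ρ₀`. -/
def rhoZero (R L α ε Λ : ℝ) : ℝ :=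
  min (deltaTub R L α ε Λ / 8)
    (min ((2 * L) ^ (-2 / α))
      (min (R ^ 2 / 2 ^ 6)
        (min ((2 : ℝ) ^ (-12 / α) * cAng L 4 ^ (-2 / α))
          (1 / (2 ^ 9 * Λ ^ 2)))))

/-- The threshold `ρ_G`: the largest number not exceeding `ρ₀` such that
`C_l ρ^{α/2} < 1` for all `ρ ∈ (0, ρ_G)`. -/
def rhoG (R L α ε Λ : ℝ) : ℝ := min (rhoZero R L α ε Λ) (cLip L Λ ^ (-2 / α))

/-- `H` is a `C¹` ambient isotopy that carries `S₂` (at time `1`) to `S₁` (at time `0`): it is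
of class `C¹` on `ℝⁿ × [0,1]`, each `H(·,t)` is a `C¹` diffeomorphism of `ℝⁿ` onto itself,
`H(·,1)` is the identity, and `H(S₂,0) = S₁`. -/
structure IsC1AmbientIsotopy {n : ℕ} (H : Euc n → ℝ → Euc n) (S₁ S₂ : Set (Euc n)) : Prop where
  contDiffOn : ContDiffOn ℝ 1 (fun p : Euc n × ℝ => H p.1 p.2) (univ ×ˢ Icc (0 : ℝ) 1)
  diffeo : ∀ t ∈ Icc (0 : ℝ) 1, ∃ g : Euc n → Euc n, ContDiff ℝ 1 g ∧
    Function.LeftInverse g (fun x => H x t) ∧ Function.RightInverse g (fun x => H x t)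
  at_one : ∀ x, H x 1 = x
  at_zero : (fun x => H x 0) '' S₂ = S₁

/-- On `S₂` the isotopy `H` is the contraction along the fibres of the `δ`-tubular neighbourhood
of `S₁` given by `Φ`: every `x ∈ S₂` is in exactly one way `x = a + v` with `(a,v)` in
the `δ`-normal neighbourhood, and `H(x,t) = a + t v`. -/
def ContractsAlongFibres {n : ℕ} (H : Euc n → ℝ → Euc n) (δ : ℝ) (S₁ S₂ : Set (Euc n))
    (Φ : Euc n → Euc n →L[ℝ] Euc n) : Prop :=
  ∀ x ∈ S₂, ∃ p ∈ normalNhd δ S₁ Φ, p.1 + p.2 = x ∧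
    (∀ q ∈ normalNhd δ S₁ Φ, q.1 + q.2 = x → q = p) ∧
    ∀ t ∈ Icc (0 : ℝ) 1, H x t = p.1 + t • p.2

end

/-! Write `π` for the foot point map `a + v ↦ a` of the tube of radius `δ` around `S₁`. If `a + v`
and `b + u` lie in the tube at distance at most `δ`, then `b - a` is almost tangent to `S₁` at `a`
by the Hölder bound, and `u - v` is almost normal there, because `Φ` varies by at most `Λ |b - a|`
and `Λ δ ≤ ε / 4`. Hence `π` increments differ from their tangential projections by at most `4 ε`
times the distance (`norm_foot_sub_le`). This gives disjointness of the fibres and Lipschitz bounds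
for `π`; the inverse function theorem gives openness of the tube and `C¹` regularity of `π`.

Let the Hausdorff distance be below `ρ = r ^ 2`. A step of length `r` along a tangent of one
submanifold ends within `L r ^ (1 + α)` of it, hence within about `r ^ 2 + L r ^ (1 + α)` of the
other one; dividing by `r`, the tangent planes differ by `O(r + L r ^ α)`. So the fibre component `x
- π x` has a small local Lipschitz constant on `S₂`, and `π` is injective there. The image `π(S₂)`
is open and closed in `S₁` and comes near every point of `S₁`, so it is all of `S₁` even if `S₁` is
disconnected.

Let `σ` be the inverse of `π` on `S₂`. The field `g = cutoff · (σ ∘ π - π)` lives on all of space,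
equals `x - π x` on `S₂` and has derivative at most `3 / 5`: the displacement is small compared with
the width `δ` of the cutoff. Then `H(x,t) = x - (1 - t) g(x)` is a contraction perturbation of the
identity for each `t`, with no flow to be integrated.

For part (2) the normal projections are averaged with bump functions over a separated net. A packing
bound makes the Lipschitz constant independent of the submanifold and of `d`. A uniformly Lipschitz
retraction, `A ↦ (1 + sign (2 A - 1)) / 2`, turns the averages back into orthogonal projections. -/

/-! ### Inverse function theorem near the identity -/

/-- A `C¹` map whose derivative at `y₀` is within distance less than `1` of the identity has a
local right inverse of class `C¹`. -/
theorem exists_contDiffAt_rightInverse {E : Type*} [NormedAddCommGroup E] [NormedSpace ℝ E]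
    [CompleteSpace E] {G : E → E} {G' : E →L[ℝ] E} {y₀ : E} (hG : ContDiffAt ℝ 1 G y₀)
    (hG' : HasFDerivAt G G' y₀) (hlt : ‖G' - ContinuousLinearMap.id ℝ E‖ < 1) :
    ∃ K : E → E, ContDiffAt ℝ 1 K (G y₀) ∧ K (G y₀) = y₀ ∧ ∀ᶠ x in 𝓝 (G y₀), G (K x) = x := by
  have hu : ‖(1 : E →L[ℝ] E) - G'‖ < 1 := by rwa [← norm_sub_rev] at hlt
  let u : (E →L[ℝ] E)ˣ := Units.oneSub _ hu
  let e : E ≃L[ℝ] E := ContinuousLinearEquiv.ofUnit u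
  have he : (e : E →L[ℝ] E) = G' := by
    ext x
    change (1 - (1 - G') : E →L[ℝ] E) x = G' x
    simp
  have hG'' : HasFDerivAt G (e : E →L[ℝ] E) y₀ := by rwa [he]
  have hs := hG.hasStrictFDerivAt' hG'' one_ne_zero
  exact ⟨hG.localInverse hG'' one_ne_zero, hG.to_localInverse hG'' one_ne_zero,
    hs.localInverse_apply_image, hs.eventually_right_inverse⟩

/-- A map to a normed space with `C¹` regularity relative to `S` is `C¹` after composition with a
`C¹` map into `S`. -/
theorem ContDiffOn.comp_contDiffAt_of_eventually {E F G : Type*} [NormedAddCommGroup E]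
    [NormedSpace ℝ E] [NormedAddCommGroup F] [NormedSpace ℝ F] [NormedAddCommGroup G]
    [NormedSpace ℝ G] {Φ : F → G} {S : Set F} {ψ : E → F} {y₀ : E} (hΦ : ContDiffOn ℝ 1 Φ S)
    (hψ : ContDiffAt ℝ 1 ψ y₀) (hS : ∀ᶠ y in 𝓝 y₀, ψ y ∈ S) :
    ContDiffAt ℝ 1 (fun y => Φ (ψ y)) y₀ :=
  ((hΦ _ hS.self_of_nhds).comp (s := {y | ψ y ∈ S}) y₀ hψ.contDiffWithinAt
    (fun _ hy => hy)).contDiffAt hS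

/-! ### Graph patches as parametrizations -/

namespace GraphPatchClass

variable {m n : ℕ} {α R L d : ℝ} {S : Set (Euc n)}

/-- Around each of its points a submanifold of the class is parametrized by a `C¹` map that is
close to the orthogonal projection to the tangent plane. -/
theorem exists_chart (hS : GraphPatchClass m n α R L d S) (hL : 0 < L) (hα : 0 < α) {a : Euc n}
    (ha : a ∈ S) :
    ∃ X : Euc n → Euc n, ContDiff ℝ 1 X ∧ X 0 = a ∧
      HasFDerivAt X (tangentPlane S a).starProjection 0 ∧
      (∀ y, ‖y‖ < R / 2 → X y ∈ S) ∧ (∀ b ∈ S, ‖b - a‖ < R → X (b - a) = b) ∧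
      (∀ y, ‖X y - a - (tangentPlane S a).starProjection y‖ ≤ L * ‖y‖ ^ α * ‖y‖) ∧
      ∀ y, ‖fderiv ℝ X y - (tangentPlane S a).starProjection‖ ≤ L * ‖y‖ ^ α := by
  have hpatch := hS.patches a ha
  generalize tangentPlane S a = T at hpatch ⊢
  obtain ⟨f, hf, hgraph, hf0, hdf0, hhol, hlip⟩ := hpatch
  let pr : Euc n →L[ℝ] T := T.orthogonalProjectionOnto
  have hprn : ∀ y, ‖pr y‖ ≤ ‖y‖ := fun y => T.norm_orthogonalProjectionOnto_apply_le y
  have hderX : ∀ y, HasFDerivAt (fun y => a + T.starProjection y + (f (pr y) : Euc n))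
      (T.starProjection + Tᗮ.subtypeL ∘L (fderiv ℝ f (pr y)) ∘L pr) y := by
    intro y
    have h1 : HasFDerivAt (fun y => f (pr y)) ((fderiv ℝ f (pr y)) ∘L pr) y :=
      ((hf.differentiable one_ne_zero) (pr y)).hasFDerivAt.comp y pr.hasFDerivAt
    have h2 : HasFDerivAt (fun y => (f (pr y) : Euc n))
        (Tᗮ.subtypeL ∘L ((fderiv ℝ f (pr y)) ∘L pr)) y :=
      (Tᗮ.subtypeL).hasFDerivAt.comp y h1
    exact (T.starProjection.hasFDerivAt.const_add a).add h2
  have hdf : ∀ ξ, ‖fderiv ℝ f ξ‖ ≤ L * ‖ξ‖ ^ α := by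
    intro ξ
    simpa [hdf0] using hhol ξ 0
  have hderbd : ∀ y, ‖Tᗮ.subtypeL ∘L (fderiv ℝ f (pr y)) ∘L pr‖ ≤ L * ‖y‖ ^ α := by
    intro y
    refine ContinuousLinearMap.opNorm_le_bound _ (by positivity) fun z => ?_
    change ‖fderiv ℝ f (pr y) (pr z)‖ ≤ _
    calc ‖fderiv ℝ f (pr y) (pr z)‖ ≤ ‖fderiv ℝ f (pr y)‖ * ‖pr z‖ :=
          ContinuousLinearMap.le_opNorm _ _
      _ ≤ (L * ‖y‖ ^ α) * ‖z‖ := by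
          gcongr
          · exact (hdf _).trans (by gcongr; exact hprn y)
          · exact hprn z
  -- The chart is defined on all of `ℝⁿ`, not only on the tangent plane, so that tangential and
  -- normal variables can later share one argument. The radius `R / 2` arises because `T y` and `f
  -- (pr y)` each have norm at most `‖y‖`.
  refine ⟨fun y => a + T.starProjection y + (f (pr y) : Euc n), ?_, ?_, ?_, ?_, ?_, ?_, ?_⟩
  · exact (contDiff_const.add T.starProjection.contDiff).add
      (Tᗮ.subtypeL.contDiff.comp (hf.comp pr.contDiff))
  · simp [hf0]
  · have := hderX 0
    simpa [hdf0] using this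
  · intro y hy
    have hmem : a + T.starProjection y + (f (pr y) : Euc n) ∈ graphOver a T f ∩ ball a R := by
      refine ⟨⟨pr y, rfl⟩, ?_⟩
      rw [mem_ball, dist_eq_norm]
      have h1 : ‖f (pr y)‖ ≤ ‖pr y‖ := by
        have := hlip.dist_le_mul (pr y) 0
        simpa [hf0] using this
      have h2 : ‖(f (pr y) : Euc n)‖ ≤ ‖y‖ := h1.trans (hprn y)
      have h3 : ‖T.starProjection y‖ ≤ ‖y‖ := hprn y
      calc ‖a + T.starProjection y + (f (pr y) : Euc n) - a‖
          = ‖T.starProjection y + (f (pr y) : Euc n)‖ := by congr 1; abel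
        _ ≤ ‖T.starProjection y‖ + ‖(f (pr y) : Euc n)‖ := norm_add_le _ _
        _ < R := by linarith
    rw [← hgraph] at hmem
    exact hmem.1
  · intro b hb hba
    have hmem : b ∈ S ∩ ball a R := ⟨hb, by rwa [mem_ball, dist_eq_norm]⟩
    rw [hgraph] at hmem
    obtain ⟨ξ, hξ⟩ := hmem.1
    have hp : pr (b - a) = ξ := by
      have : b - a = (ξ : Euc n) + (f ξ : Euc n) := by rw [hξ]; abel
      rw [this, map_add]
      simp [pr]
    change a + ((pr (b - a) : T) : Euc n) + (f (pr (b - a)) : Euc n) = b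
    rw [hp, ← hξ]
  · intro y
    have key : ‖f (pr y) - f 0‖ ≤ (L * ‖y‖ ^ α) * ‖pr y - 0‖ := by
      refine (convex_closedBall (0 : T) ‖y‖).norm_image_sub_le_of_norm_fderiv_le
        (fun ξ _ => (hf.differentiable one_ne_zero) ξ) (fun ξ hξ => ?_) ?_ ?_
      · refine (hdf ξ).trans ?_
        rw [mem_closedBall_zero_iff] at hξ
        gcongr
      · simp
      · rw [mem_closedBall_zero_iff]; exact hprn y
    have h1 : a + T.starProjection y + (f (pr y) : Euc n) - a - T.starProjection y
        = (f (pr y) : Euc n) := by abel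
    rw [h1]
    rw [hf0, sub_zero, sub_zero] at key
    exact key.trans (by gcongr; exact hprn y)
  · intro y
    rw [(hderX y).fderiv, add_sub_cancel_left]
    exact hderbd y

/-- Nearby points of the submanifold lie close to the tangent plane. -/
theorem norm_orthogonal_sub_le (hS : GraphPatchClass m n α R L d S) (hL : 0 < L) (hα : 0 < α)
    {a b : Euc n} (ha : a ∈ S) (hb : b ∈ S) (hab : ‖b - a‖ < R) :
    ‖(b - a) - (tangentPlane S a).starProjection (b - a)‖ ≤ L * ‖b - a‖ ^ α * ‖b - a‖ := by
  obtain ⟨X, -, -, -, -, hX, hest, -⟩ := hS.exists_chart hL hα ha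
  have := hest (b - a)
  rwa [hX b hb hab] at this

end GraphPatchClass

/-! ### The tubular neighbourhood given by a normal map -/

noncomputable section

/-- A submanifold with an `ε`-normal map, and a radius `δ` that is small in terms of the
constants, so that the fibres of length `δ` do not meet. -/
structure HasNormalTube {n : ℕ} (m : ℕ) (α R L d ε : ℝ) (Λ : ℝ≥0) (δ : ℝ) (S : Set (Euc n))
    (Φ : Euc n → Euc n →L[ℝ] Euc n) : Prop where
  patch : GraphPatchClass m n α R L d S
  normal : IsNormalMap m ε S Φ
  lipschitz : LipschitzOnWith Λ Φ S
  L_pos : 0 < L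
  α_pos : 0 < α
  ε_pos : 0 < ε
  ε_lt : ε < 1 / 100
  δ_pos : 0 < δ
  δ_le_R : 4 * δ ≤ R
  holder_le : L * (4 * δ) ^ α ≤ ε
  lip_le : Λ * δ ≤ ε / 4

/-- The points `a + v` with `(a, v)` in the normal neighbourhood. -/
def normalTube {n : ℕ} (δ : ℝ) (S : Set (Euc n)) (Φ : Euc n → Euc n →L[ℝ] Euc n) :
    Set (Euc n) :=
  {x | ∃ p ∈ normalNhd δ S Φ, p.1 + p.2 = x}

open Classical in
/-- The foot point of the fibre through a point of the tube. -/
def tubeProj {n : ℕ} (δ : ℝ) (S : Set (Euc n)) (Φ : Euc n → Euc n →L[ℝ] Euc n) (x : Euc n) :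
    Euc n :=
  if h : ∃ p ∈ normalNhd δ S Φ, p.1 + p.2 = x then h.choose.1 else 0

theorem tubeProj_mem_normalNhd {n : ℕ} {δ : ℝ} {S : Set (Euc n)}
    {Φ : Euc n → Euc n →L[ℝ] Euc n} {x : Euc n} (hx : x ∈ normalTube δ S Φ) :
    (tubeProj δ S Φ x, x - tubeProj δ S Φ x) ∈ normalNhd δ S Φ := by
  have hx' : ∃ p ∈ normalNhd δ S Φ, p.1 + p.2 = x := hx
  have hspec := hx'.choose_spec
  have h : x - tubeProj δ S Φ x = hx'.choose.2 := by
    rw [tubeProj, dif_pos hx', sub_eq_iff_eq_add', hspec.2]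
  rw [h, tubeProj, dif_pos hx']
  exact hspec.1

namespace HasNormalTube

variable {m n : ℕ} {α R L d ε δ : ℝ} {Λ : ℝ≥0} {S : Set (Euc n)}
  {Φ : Euc n → Euc n →L[ℝ] Euc n}

theorem norm_sub_starProjection_le (h : HasNormalTube m α R L d ε Λ δ S Φ) {a b : Euc n}
    (ha : a ∈ S) (hb : b ∈ S) (hab : ‖b - a‖ ≤ 3 * δ) :
    ‖(b - a) - (tangentPlane S a).starProjection (b - a)‖ ≤ ε * ‖b - a‖ := by
  have hδ := h.δ_pos
  have hL := h.L_pos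
  have hα := h.α_pos
  refine (h.patch.norm_orthogonal_sub_le h.L_pos h.α_pos ha hb
    (by linarith [h.δ_le_R])).trans ?_
  gcongr
  refine le_trans ?_ h.holder_le
  gcongr
  linarith

theorem norm_normal_sub_le (h : HasNormalTube m α R L d ε Λ δ S Φ) {a : Euc n} (ha : a ∈ S)
    (x : Euc n) : ‖Φ a x - (x - (tangentPlane S a).starProjection x)‖ ≤ ε * ‖x‖ := by
  have h1 := ContinuousLinearMap.le_of_opNorm_le _ (h.normal.near_normal a ha) x
  rwa [sub_apply, Submodule.starProjection_orthogonal_val] at h1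

/-- Split `z = w + (u - v)` with `w = b - a`. The part `w` is tangential up to `ε ‖w‖`. The defect
of `u - v` from being fixed by `Φ a` is `(Φ b - Φ a) u`, of size at most `Λ δ ‖w‖`, and `Φ a` is the
normal projection up to `ε`. Projecting `z` to the tangent plane therefore returns nearly `w`. -/
theorem norm_foot_sub_le (h : HasNormalTube m α R L d ε Λ δ S Φ) {p q : Euc n × Euc n}
    (hp : p ∈ normalNhd δ S Φ) (hq : q ∈ normalNhd δ S Φ)
    (hpq : ‖(q.1 + q.2) - (p.1 + p.2)‖ ≤ δ) :
    ‖q.1 - p.1 - (tangentPlane S p.1).starProjection ((q.1 + q.2) - (p.1 + p.2))‖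
      ≤ 4 * ε * ‖(q.1 + q.2) - (p.1 + p.2)‖ := by
  obtain ⟨a, v⟩ := p
  obtain ⟨b, u⟩ := q
  obtain ⟨ha, hv, hvδ⟩ := hp
  obtain ⟨hb, hu, huδ⟩ := hq
  dsimp only at *
  set T := (tangentPlane S a).starProjection with hT
  set w := b - a with hw
  set z := (b + u) - (a + v) with hz
  have hε := h.ε_pos
  have hε1 := h.ε_lt
  have huv : u - v = z - w := by rw [hz, hw]; abel
  have huvn : ‖u - v‖ ≤ ‖z‖ + ‖w‖ := by rw [huv]; exact norm_sub_le _ _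
  have hwn : ‖w‖ ≤ 3 * δ := by
    have : w = z - u + v := by rw [hz, hw]; abel
    rw [this]
    linarith [norm_add_le (z - u) v, norm_sub_le z u]
  have h1 : ‖w - T w‖ ≤ ε * ‖w‖ := h.norm_sub_starProjection_le ha hb hwn
  have h2 : ‖(u - v) - Φ a (u - v)‖ ≤ ε / 4 * ‖w‖ := by
    have e : (u - v) - Φ a (u - v) = (Φ b - Φ a) u := by
      rw [map_sub, hv, sub_apply, hu]; abel
    rw [e]
    have hl := h.lipschitz.dist_le_mul b hb a ha
    rw [dist_eq_norm, dist_eq_norm] at hl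
    calc ‖(Φ b - Φ a) u‖ ≤ ‖Φ b - Φ a‖ * ‖u‖ := ContinuousLinearMap.le_opNorm _ _
      _ ≤ (Λ * ‖w‖) * δ := by gcongr
      _ = (Λ * δ) * ‖w‖ := by ring
      _ ≤ ε / 4 * ‖w‖ := by gcongr; exact h.lip_le
  have h3 := h.norm_normal_sub_le ha (u - v)
  rw [← hT] at h3
  have h4 : ‖w - T z‖ ≤ ε * ‖w‖ + ε / 4 * ‖w‖ + ε * ‖u - v‖ := by
    have e : w - T z = (w - T w) - ((u - v) - Φ a (u - v))
        - (Φ a (u - v) - ((u - v) - T (u - v))) := by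
      have : z = w + (u - v) := by rw [huv]; abel
      rw [this, map_add]; abel
    rw [e]
    linarith [norm_sub_le ((w - T w) - ((u - v) - Φ a (u - v)))
      (Φ a (u - v) - ((u - v) - T (u - v))), norm_sub_le (w - T w) ((u - v) - Φ a (u - v))]
  have h5 : ‖T z‖ ≤ ‖z‖ := Submodule.norm_starProjection_apply_le _ _
  have h6 : ‖w‖ ≤ ‖w - T z‖ + ‖T z‖ := by
    have := norm_add_le (w - T z) (T z); rwa [sub_add_cancel] at this
  -- Since `‖T z‖ ≤ ‖z‖`, the terms in `‖w‖` on the right are absorbed; the error then becomes `(9 /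
  -- 4) (11 / 10) ε + ε < 4 ε` times `‖z‖`.
  have hwz : ‖w‖ ≤ 11 / 10 * ‖z‖ := by
    nlinarith [norm_nonneg w, norm_nonneg z]
  nlinarith [norm_nonneg w, norm_nonneg z]

/-- Two fibres through one point have increment `0`, so the foot point estimate forces equal feet.
-/
theorem eq_of_add_eq (h : HasNormalTube m α R L d ε Λ δ S Φ) {p q : Euc n × Euc n}
    (hp : p ∈ normalNhd δ S Φ) (hq : q ∈ normalNhd δ S Φ) (hpq : q.1 + q.2 = p.1 + p.2) :
    q = p := by
  have h0 : (q.1 + q.2) - (p.1 + p.2) = 0 := sub_eq_zero.2 hpq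
  have h1 := h.norm_foot_sub_le hp hq (by rw [h0, norm_zero]; exact h.δ_pos.le)
  rw [h0] at h1
  simp only [map_zero, sub_zero, norm_zero, mul_zero, norm_le_zero_iff] at h1
  have h2 : q.1 = p.1 := sub_eq_zero.1 h1
  refine Prod.ext h2 ?_
  rw [h2] at hpq
  exact add_left_cancel hpq

theorem tubeProj_add (h : HasNormalTube m α R L d ε Λ δ S Φ) {p : Euc n × Euc n}
    (hp : p ∈ normalNhd δ S Φ) : tubeProj δ S Φ (p.1 + p.2) = p.1 := by
  have hx : p.1 + p.2 ∈ normalTube δ S Φ := ⟨p, hp, rfl⟩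
  exact congrArg Prod.fst (h.eq_of_add_eq hp (tubeProj_mem_normalNhd hx) (by simp))

theorem mem_normalNhd_zero (h : HasNormalTube m α R L d ε Λ δ S Φ) {a : Euc n} (ha : a ∈ S) :
    (a, (0 : Euc n)) ∈ normalNhd δ S Φ :=
  ⟨ha, map_zero _, by simpa using h.δ_pos⟩

theorem tubeProj_self (h : HasNormalTube m α R L d ε Λ δ S Φ) {a : Euc n} (ha : a ∈ S) :
    tubeProj δ S Φ a = a := by
  simpa using h.tubeProj_add (h.mem_normalNhd_zero ha)

theorem subset_normalTube (h : HasNormalTube m α R L d ε Λ δ S Φ) : S ⊆ normalTube δ S Φ :=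
  fun a ha => ⟨(a, 0), h.mem_normalNhd_zero ha, add_zero a⟩

/-- The foot point map is close to the orthogonal projection to the tangent plane. -/
theorem norm_tubeProj_sub_le (h : HasNormalTube m α R L d ε Λ δ S Φ) {x y : Euc n}
    (hx : x ∈ normalTube δ S Φ) (hy : y ∈ normalTube δ S Φ) (hxy : ‖y - x‖ ≤ δ) :
    ‖tubeProj δ S Φ y - tubeProj δ S Φ x
      - (tangentPlane S (tubeProj δ S Φ x)).starProjection (y - x)‖ ≤ 4 * ε * ‖y - x‖ := by
  have := h.norm_foot_sub_le (tubeProj_mem_normalNhd hx) (tubeProj_mem_normalNhd hy)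
    (by simpa using hxy)
  simpa using this

/-- Maps into `S` that are transverse to the fibres of the normal map straighten the tube. -/
theorem exists_local_fibration (h : HasNormalTube m α R L d ε Λ δ S Φ) {ψ : Euc n → Euc n}
    {ψ' : Euc n →L[ℝ] Euc n} {y₀ : Euc n} (hψ : ContDiffAt ℝ 1 ψ y₀)
    (hψ' : HasFDerivAt ψ ψ' y₀) (hS : ∀ᶠ y in 𝓝 y₀, ψ y ∈ S) (hy₀ : Φ (ψ y₀) y₀ = y₀)
    (hδ : ‖y₀‖ < δ) (hclose : ‖ψ' - (tangentPlane S (ψ y₀)).starProjection‖ ≤ 1 / 2) :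
    ∃ K : Euc n → Euc n, ContDiffAt ℝ 1 K (ψ y₀ + y₀) ∧ K (ψ y₀ + y₀) = y₀ ∧
      ∀ᶠ x in 𝓝 (ψ y₀ + y₀), x ∈ normalTube δ S Φ ∧ tubeProj δ S Φ x = ψ (K x) := by
  set a := ψ y₀ with ha
  have haS : a ∈ S := hS.self_of_nhds
  set T := (tangentPlane S a).starProjection with hT
  have hε := h.ε_pos
  have hε1 := h.ε_lt
  have hΘ : ContDiffAt ℝ 1 (fun y => Φ (ψ y)) y₀ :=
    h.normal.contDiffOn.comp_contDiffAt_of_eventually hψ hS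
  have hΘ' : HasFDerivAt (fun y => Φ (ψ y)) (fderiv ℝ (fun y => Φ (ψ y)) y₀) y₀ :=
    (hΘ.differentiableAt one_ne_zero).hasFDerivAt
  set Θ' := fderiv ℝ (fun y => Φ (ψ y)) y₀ with hΘdef
  have hψn : ‖ψ'‖ ≤ 3 / 2 := by
    have h1 : ‖T‖ ≤ 1 := Submodule.starProjection_norm_le _
    have := norm_add_le (ψ' - T) T
    rw [sub_add_cancel] at this
    linarith
  -- `Φ` is controlled only on `S`, but `ψ` takes values there; its local Lipschitz constant is at
  -- most `3 / 2 + 1 / 2`.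
  have hΘn : ‖Θ'‖ ≤ Λ * 2 := by
    refine hΘ'.le_of_lip' (by positivity) ?_
    have hlo : ∀ᶠ y in 𝓝 y₀, ‖ψ y - ψ y₀ - ψ' (y - y₀)‖ ≤ 1 / 2 * ‖y - y₀‖ :=
      hψ'.isLittleO.def (by norm_num)
    filter_upwards [hS, hlo] with y hy hy2
    have hl := h.lipschitz.dist_le_mul (ψ y) hy a haS
    rw [dist_eq_norm, dist_eq_norm] at hl
    refine hl.trans ?_
    rw [mul_assoc]
    gcongr
    have h1 : ‖ψ' (y - y₀)‖ ≤ 3 / 2 * ‖y - y₀‖ := ψ'.le_of_opNorm_le hψn _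
    have h2 := norm_add_le (ψ y - ψ y₀ - ψ' (y - y₀)) (ψ' (y - y₀))
    rw [sub_add_cancel] at h2
    linarith
  -- A single variable `y` moves both the foot `ψ y` and the fibre vector `Φ (ψ y) y`. The
  -- derivative is close to `T + (1 - T) = 1`, with error at most `1 / 2 + ε + ε / 2 < 3 / 4`, the
  -- last term coming from the variation of `Φ`.
  have hG : ContDiffAt ℝ 1 (fun y => ψ y + Φ (ψ y) y) y₀ := hψ.add (hΘ.clm_apply contDiffAt_id)
  have hG' := hψ'.add (hΘ'.clm_apply (hasFDerivAt_id y₀))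
  have hG0 : ψ y₀ + Φ (ψ y₀) y₀ = a + y₀ := by rw [hy₀]
  obtain ⟨K, hK, hK0, hKr⟩ := exists_contDiffAt_rightInverse hG hG' (by
    refine lt_of_le_of_lt (ContinuousLinearMap.opNorm_le_bound _ (M := 3 / 4) (by norm_num)
      fun z => ?_) (by norm_num : (3 / 4 : ℝ) < 1)
    have e : (ψ' + ((Φ (ψ y₀)).comp (ContinuousLinearMap.id ℝ (Euc n)) + Θ'.flip y₀)
        - ContinuousLinearMap.id ℝ (Euc n)) z
        = (ψ' - T) z + (Φ a z - (z - T z)) + Θ' z y₀ := by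
      simp only [add_apply, sub_apply, ContinuousLinearMap.comp_id,
        ContinuousLinearMap.flip_apply, ContinuousLinearMap.id_apply, ← ha]
      abel
    change ‖(ψ' + ((Φ (ψ y₀)).comp (ContinuousLinearMap.id ℝ (Euc n)) + Θ'.flip y₀)
        - ContinuousLinearMap.id ℝ (Euc n)) z‖ ≤ _
    rw [e]
    have h1 : ‖(ψ' - T) z‖ ≤ 1 / 2 * ‖z‖ := ContinuousLinearMap.le_of_opNorm_le _ hclose z
    have h2 := h.norm_normal_sub_le haS z
    have h3 : ‖Θ' z y₀‖ ≤ ε / 2 * ‖z‖ := by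
      calc ‖Θ' z y₀‖ ≤ ‖Θ' z‖ * ‖y₀‖ := ContinuousLinearMap.le_opNorm _ _
        _ ≤ (Λ * 2 * ‖z‖) * δ := by
            gcongr
            exact Θ'.le_of_opNorm_le hΘn z
        _ = 2 * (Λ * δ) * ‖z‖ := by ring
        _ ≤ ε / 2 * ‖z‖ := by
            gcongr
            linarith [h.lip_le]
    have h4 := norm_add_le ((ψ' - T) z + (Φ a z - (z - T z))) (Θ' z y₀)
    have h5 := norm_add_le ((ψ' - T) z) (Φ a z - (z - T z))
    nlinarith [norm_nonneg z])
  rw [hG0] at hK hK0 hKr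
  refine ⟨K, hK, hK0, ?_⟩
  have hKt : Filter.Tendsto K (𝓝 (a + y₀)) (𝓝 y₀) := by
    have := hK.continuousAt.tendsto
    rwa [hK0] at this
  have hsmall : ∀ᶠ y in 𝓝 y₀, ‖Φ (ψ y) y‖ < δ := by
    have hc : ContinuousAt (fun y => ‖Φ (ψ y) y‖) y₀ :=
      (hΘ.clm_apply contDiffAt_id).continuousAt.norm
    refine hc.eventually_lt continuousAt_const ?_
    rwa [← ha, hy₀]
  filter_upwards [hKr, hKt.eventually hS, hKt.eventually hsmall] with x hx hxS hxδ
  have hmem : (ψ (K x), Φ (ψ (K x)) (K x)) ∈ normalNhd δ S Φ :=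
    ⟨hxS, DFunLike.congr_fun (h.normal.mapsTo hxS).1 (K x), hxδ⟩
  have heq : tubeProj δ S Φ (ψ (K x) + Φ (ψ (K x)) (K x)) = ψ (K x) := h.tubeProj_add hmem
  exact ⟨⟨_, hmem, hx⟩, by rwa [hx] at heq⟩

/-- The chart at the foot, translated to `y ↦ X (y - v)`, has value `a` and derivative exactly the
tangential projection at `y = v`. The local fibration thus expresses the foot point map through a
`C¹` local inverse. -/
theorem eventually_mem_normalTube (h : HasNormalTube m α R L d ε Λ δ S Φ) {x : Euc n}
    (hx : x ∈ normalTube δ S Φ) :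
    (∀ᶠ y in 𝓝 x, y ∈ normalTube δ S Φ) ∧ ContDiffAt ℝ 1 (tubeProj δ S Φ) x := by
  obtain ⟨haS, hv, hvδ⟩ := tubeProj_mem_normalNhd hx
  set a := tubeProj δ S Φ x with ha
  obtain ⟨X, hX, hX0, hX', hXS, -, -, -⟩ := h.patch.exists_chart h.L_pos h.α_pos haS
  set v := x - a with hvdef
  have hsub : HasFDerivAt (fun y => y - v) (ContinuousLinearMap.id ℝ (Euc n)) v :=
    (hasFDerivAt_id v).sub_const v
  have hψ' : HasFDerivAt (fun y => X (y - v)) (tangentPlane S a).starProjection v := by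
    have h1 : HasFDerivAt X (tangentPlane S a).starProjection (v - v) := by rwa [sub_self]
    exact HasFDerivAt.comp (f := fun y => y - v) v h1 hsub
  have hψ0 : X (v - v) = a := by rw [sub_self, hX0]
  have hR : 0 < R := by linarith [h.δ_pos, h.δ_le_R]
  obtain ⟨K, hK, hK0, hKe⟩ := h.exists_local_fibration (ψ := fun y => X (y - v)) (y₀ := v)
    (hX.comp (contDiff_id.sub contDiff_const)).contDiffAt hψ' (by
      have hc : ContinuousAt (fun y : Euc n => ‖y - v‖) v := by fun_prop
      filter_upwards [hc.eventually_lt (continuousAt_const (y := R / 2)) (by simpa using hR)]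
        with y hy using hXS _ hy) (by rw [hψ0]; exact hv) hvδ
      (by rw [hψ0, sub_self, norm_zero]; norm_num)
  have hxe : X (v - v) + v = x := by rw [hψ0, hvdef]; abel
  rw [hxe] at hK hK0 hKe
  refine ⟨hKe.mono fun _ hy => hy.1, ?_⟩
  refine ContDiffAt.congr_of_eventuallyEq ?_ (hKe.mono fun _ hy => hy.2)
  exact (hX.contDiffAt.comp x (hK.sub contDiffAt_const))

theorem isOpen_normalTube (h : HasNormalTube m α R L d ε Λ δ S Φ) : IsOpen (normalTube δ S Φ) :=
  isOpen_iff_mem_nhds.2 fun _ hx => (h.eventually_mem_normalTube hx).1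

theorem contDiffAt_tubeProj (h : HasNormalTube m α R L d ε Λ δ S Φ) {x : Euc n}
    (hx : x ∈ normalTube δ S Φ) : ContDiffAt ℝ 1 (tubeProj δ S Φ) x :=
  (h.eventually_mem_normalTube hx).2

/-- The points of the tube at fibre distance at most `r` from `S` form a closed set. -/
theorem isClosed_tube (h : HasNormalTube m α R L d ε Λ δ S Φ) (r : ℝ) :
    IsClosed {x | ∃ a ∈ S, ∃ v, Φ a v = v ∧ ‖v‖ ≤ r ∧ a + v = x} := by
  have hSc : IsCompact S := h.patch.submanifold.1
  have hcont : ContinuousOn (fun p : Euc n × Euc n => Φ p.1 p.2 - p.2)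
      (S ×ˢ closedBall (0 : Euc n) r) := by
    have h1 : ContinuousOn (fun p : Euc n × Euc n => Φ p.1) (S ×ˢ closedBall (0 : Euc n) r) :=
      h.normal.contDiffOn.continuousOn.comp continuousOn_fst fun p hp => hp.1
    exact (h1.clm_apply continuousOn_snd).sub continuousOn_snd
  have hK : IsCompact (S ×ˢ closedBall (0 : Euc n) r) := hSc.prod (isCompact_closedBall _ _)
  have hcl := hcont.preimage_isClosed_of_isClosed hK.isClosed (isClosed_singleton (x := 0))
  have hK2 := hK.of_isClosed_subset hcl inter_subset_left
  have := (hK2.image (f := fun p : Euc n × Euc n => p.1 + p.2) (by fun_prop)).isClosed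
  convert this using 1
  ext x
  constructor
  · rintro ⟨a, ha, v, hv, hvr, rfl⟩
    exact ⟨(a, v), ⟨⟨ha, by simpa using hvr⟩, by simp [hv]⟩, rfl⟩
  · rintro ⟨⟨a, v⟩, ⟨⟨ha, hvr⟩, hv⟩, rfl⟩
    exact ⟨a, ha, v, sub_eq_zero.1 hv, by simpa using hvr, rfl⟩

/-- The normal projection has norm at most `1` and the error is `4 ε < 4 / 100`; together they give
`104 / 100`. -/
theorem norm_sub_tubeProj_sub_le (h : HasNormalTube m α R L d ε Λ δ S Φ) {x y : Euc n}
    (hx : x ∈ normalTube δ S Φ) (hy : y ∈ normalTube δ S Φ) (hxy : ‖y - x‖ ≤ δ) :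
    ‖(y - tubeProj δ S Φ y) - (x - tubeProj δ S Φ x)‖ ≤ 104 / 100 * ‖y - x‖ := by
  have h1 := h.norm_tubeProj_sub_le hx hy hxy
  set T := tangentPlane S (tubeProj δ S Φ x)
  have h2 : ‖(y - x) - T.starProjection (y - x)‖ ≤ ‖y - x‖ := by
    rw [← Submodule.starProjection_orthogonal_val]
    exact Submodule.norm_starProjection_apply_le _ _
  have e : (y - tubeProj δ S Φ y) - (x - tubeProj δ S Φ x) = ((y - x) - T.starProjection (y - x))
      - (tubeProj δ S Φ y - tubeProj δ S Φ x - T.starProjection (y - x)) := by abel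
  rw [e]
  have h3 := norm_sub_le ((y - x) - T.starProjection (y - x))
    (tubeProj δ S Φ y - tubeProj δ S Φ x - T.starProjection (y - x))
  nlinarith [h.ε_lt, norm_nonneg (y - x)]

theorem norm_tubeProj_sub_tubeProj_le (h : HasNormalTube m α R L d ε Λ δ S Φ) {x y : Euc n}
    (hx : x ∈ normalTube δ S Φ) (hy : y ∈ normalTube δ S Φ) (hxy : ‖y - x‖ ≤ δ) :
    ‖tubeProj δ S Φ y - tubeProj δ S Φ x‖ ≤ 104 / 100 * ‖y - x‖ := by
  have h1 := h.norm_tubeProj_sub_le hx hy hxy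
  set T := tangentPlane S (tubeProj δ S Φ x)
  have h2 : ‖T.starProjection (y - x)‖ ≤ ‖y - x‖ := Submodule.norm_starProjection_apply_le _ _
  have h3 := norm_add_le (tubeProj δ S Φ y - tubeProj δ S Φ x - T.starProjection (y - x))
    (T.starProjection (y - x))
  rw [sub_add_cancel] at h3
  nlinarith [h.ε_lt, norm_nonneg (y - x)]

theorem norm_sub_tubeProj_le (h : HasNormalTube m α R L d ε Λ δ S Φ) {a x : Euc n}
    (ha : a ∈ S) (hx : x ∈ normalTube δ S Φ) (hxa : ‖x - a‖ ≤ δ) :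
    ‖x - tubeProj δ S Φ x‖ ≤ 104 / 100 * ‖x - a‖ := by
  have := h.norm_sub_tubeProj_sub_le (h.subset_normalTube ha) hx hxa
  rwa [h.tubeProj_self ha, sub_self, sub_zero] at this

/-- Balls of radius at most `δ / 2` around points of `S` lie in the tube. -/
theorem ball_subset_normalTube (h : HasNormalTube m α R L d ε Λ δ S Φ) {a : Euc n} (ha : a ∈ S) :
    ball a (δ / 2) ⊆ normalTube δ S Φ := by
  have hδ := h.δ_pos
  -- The tube is open, and inside the ball its fibre lengths stay below `3 / 4 * δ`, so limits do
  -- not leave it. An open and relatively closed nonempty part of a connected ball is the whole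
  -- ball.
  refine (convex_ball a (δ / 2)).isPreconnected.subset_of_closure_inter_subset
    h.isOpen_normalTube ⟨a, mem_ball_self (by linarith), h.subset_normalTube ha⟩ ?_
  rintro x ⟨hxc, hxb⟩
  have hx : x ∈ closure (normalTube δ S Φ ∩ ball a (δ / 2)) := by
    rw [inter_comm]
    exact isOpen_ball.inter_closure ⟨hxb, hxc⟩
  have hsub : normalTube δ S Φ ∩ ball a (δ / 2)
      ⊆ {x | ∃ a ∈ S, ∃ v, Φ a v = v ∧ ‖v‖ ≤ 3 / 4 * δ ∧ a + v = x} := by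
    rintro y ⟨hyt, hyb⟩
    rw [mem_ball, dist_eq_norm] at hyb
    have h1 := h.norm_sub_tubeProj_le ha hyt (by linarith)
    have h2 := tubeProj_mem_normalNhd hyt
    exact ⟨_, h2.1, _, h2.2.1, by linarith, add_sub_cancel _ _⟩
  obtain ⟨b, hb, v, hv, hvδ, rfl⟩ := closure_minimal hsub (h.isClosed_tube _) hx
  exact ⟨(b, v), ⟨hb, hv, by dsimp only; linarith⟩, rfl⟩

end HasNormalTube

/-! ### Closeness of tangent planes -/

theorem Submodule.norm_sub_starProjection_le_norm {n : ℕ} (V : Submodule ℝ (Euc n)) (z : Euc n) :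
    ‖z - V.starProjection z‖ ≤ ‖z‖ := by
  rw [← Submodule.starProjection_orthogonal_val]
  exact Submodule.norm_starProjection_apply_le _ _

/-- If `V` is almost contained in `W`, then `Wᗮ` is almost orthogonal to `V`. -/
theorem Submodule.norm_starProjection_sub_le {n : ℕ} {V W : Submodule ℝ (Euc n)} {θ : ℝ}
    (hθ : 0 ≤ θ) (h : ∀ z ∈ V, ‖z - W.starProjection z‖ ≤ θ * ‖z‖) (z : Euc n) :
    ‖V.starProjection (z - W.starProjection z)‖ ≤ θ * ‖z‖ := by
  set w := z - W.starProjection z with hw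
  set u := V.starProjection w with hu
  have huV : u ∈ V := V.starProjection_apply_mem w
  have hwW : w ∈ Wᗮ := W.sub_starProjection_mem_orthogonal z
  -- Since `w - u ⊥ V` and `w ⊥ W`, only the component of `u ∈ V` normal to `W` pairs with `w`, and
  -- that component is small by hypothesis.
  have h1 : inner ℝ u u = inner ℝ w (u - W.starProjection u) := by
    have e1 : inner ℝ w (W.starProjection u) = 0 := by
      rw [real_inner_comm]
      exact (W.mem_orthogonal w).1 hwW _ (W.starProjection_apply_mem u)
    have e2 : inner ℝ (w - u) u = 0 := V.starProjection_inner_eq_zero w u huV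
    rw [inner_sub_left] at e2
    rw [inner_sub_right, e1]
    linarith
  have h2 : ‖u‖ * ‖u‖ ≤ ‖w‖ * (θ * ‖u‖) := by
    rw [← real_inner_self_eq_norm_mul_norm, h1]
    exact (real_inner_le_norm _ _).trans (by gcongr; exact h u huV)
  have h3 : ‖w‖ ≤ ‖z‖ := W.norm_sub_starProjection_le_norm z
  rcases eq_or_lt_of_le (norm_nonneg u) with h0 | h0
  · rw [← h0]
    positivity
  · have h4 : ‖u‖ ≤ θ * ‖w‖ := by
      by_contra hcon
      nlinarith
    exact h4.trans (by gcongr)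

namespace GraphPatchClass

variable {m n : ℕ} {α R L d r : ℝ} {S S' : Set (Euc n)}

/-- If every point of `S'` is within distance `r ^ 2` of `S`, then the tangent planes of `S'` are
close to those of `S`. -/
theorem norm_tangent_sub_le (hS : GraphPatchClass m n α R L d S)
    (hS' : GraphPatchClass m n α R L d S') (hL : 0 < L) (hα : 0 < α) (hα1 : α ≤ 1) (hr : 0 < r)
    (hrR : 8 * r ≤ R) (hrL : L * r ^ α ≤ 1 / 10 ^ 4) (hr1 : r ≤ 1 / 10 ^ 4)
    (hnear : ∀ x ∈ S', ∃ a ∈ S, ‖x - a‖ ≤ r * r) {x a : Euc n} (hx : x ∈ S') (ha : a ∈ S)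
    (hxa : ‖x - a‖ ≤ 2 * (r * r)) {z : Euc n} (hz : z ∈ tangentPlane S' x) :
    ‖z - (tangentPlane S a).starProjection z‖ ≤ 1 / 1000 * ‖z‖ := by
  rcases eq_or_ne z 0 with rfl | hz0
  · simp
  have hzn : 0 < ‖z‖ := norm_pos_iff.2 hz0
  obtain ⟨X, -, -, -, hXS, -, hXest, -⟩ := hS'.exists_chart hL hα hx
  set T := tangentPlane S a with hT
  -- Rescale to a step of length `r`: the distance `r * r` to `S` and the Hölder error `L * r ^ α *
  -- r` are then both small multiples of the step.
  set t := r / ‖z‖ with ht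
  have htpos : 0 < t := by positivity
  set y := t • z with hy
  have hyn : ‖y‖ = r := by
    rw [hy, norm_smul, Real.norm_of_nonneg htpos.le, ht]; field_simp
  have hyT : (tangentPlane S' x).starProjection y = y :=
    Submodule.starProjection_eq_self_iff.2 (Submodule.smul_mem _ _ hz)
  have hp : X y ∈ S' := hXS y (by rw [hyn]; linarith)
  have hpe := hXest y
  rw [hyT, hyn] at hpe
  have hpe' : ‖X y - x - y‖ ≤ 1 / 10 ^ 4 * r := hpe.trans (by gcongr)
  obtain ⟨q, hq, hpq⟩ := hnear _ hp
  have hrr : r * r ≤ 1 / 10 ^ 4 * r := by gcongr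
  set e := (X y - q) - (X y - x - y) - (x - a) with he
  have hye : y = (q - a) + e := by rw [he]; abel
  have hen : ‖e‖ ≤ 4 / 10 ^ 4 * r := by
    have h1 := norm_sub_le ((X y - q) - (X y - x - y)) (x - a)
    have h2 := norm_sub_le (X y - q) (X y - x - y)
    linarith
  have hqa : ‖q - a‖ ≤ 2 * r := by
    have h1 : q - a = y - e := by rw [hye]; abel
    rw [h1]
    linarith [norm_sub_le y e]
  have h1 := hS.norm_orthogonal_sub_le hL hα ha hq (by linarith)
  have h2 : L * ‖q - a‖ ^ α * ‖q - a‖ ≤ 4 / 10 ^ 4 * r := by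
    have h3 : (2 : ℝ) ^ α ≤ 2 := by
      simpa using Real.rpow_le_rpow_of_exponent_le (by norm_num : (1 : ℝ) ≤ 2) hα1
    calc L * ‖q - a‖ ^ α * ‖q - a‖ ≤ L * (2 * r) ^ α * (2 * r) := by gcongr
      _ = (2 : ℝ) ^ α * (L * r ^ α) * (2 * r) := by
          rw [Real.mul_rpow (by norm_num) hr.le]; ring
      _ ≤ 2 * (1 / 10 ^ 4) * (2 * r) := by gcongr
      _ = 4 / 10 ^ 4 * r := by ring
  have h3 : ‖e - T.starProjection e‖ ≤ ‖e‖ := T.norm_sub_starProjection_le_norm e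
  have h4 : ‖y - T.starProjection y‖ ≤ 1 / 1000 * r := by
    have h5 : y - T.starProjection y
        = ((q - a) - T.starProjection (q - a)) + (e - T.starProjection e) := by
      rw [hye, map_add]; abel
    rw [h5]
    have := norm_add_le ((q - a) - T.starProjection (q - a)) (e - T.starProjection e)
    linarith
  have h6 : y - T.starProjection y = t • (z - T.starProjection z) := by
    rw [hy, map_smul, smul_sub]
  rw [h6, norm_smul, Real.norm_of_nonneg htpos.le] at h4
  have h7 : r = t * ‖z‖ := by rw [ht]; field_simp
  rw [h7] at h4
  refine le_of_mul_le_mul_left ?_ htpos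
  linarith

end GraphPatchClass

/-! ### The foot point map from `S₂` onto `S₁` -/

/-- Two submanifolds at Hausdorff distance at most `r ^ 2`, the first of them with a tube. -/
structure IsCloseToTube {n : ℕ} (m : ℕ) (α R L d ε : ℝ) (Λ : ℝ≥0) (δ r : ℝ)
    (S₁ S₂ : Set (Euc n)) (Φ : Euc n → Euc n →L[ℝ] Euc n) : Prop
    extends HasNormalTube m α R L d ε Λ δ S₁ Φ where
  patch' : GraphPatchClass m n α R L d S₂
  α_le : α ≤ 1
  r_pos : 0 < r
  r_le_R : 8 * r ≤ R
  holder_r_le : L * r ^ α ≤ 1 / 10 ^ 4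
  r_le : r ≤ 1 / 10 ^ 4
  sq_le : 8 * (r * r) ≤ δ
  near : ∀ a ∈ S₁, ∃ x ∈ S₂, ‖a - x‖ ≤ r * r
  near' : ∀ x ∈ S₂, ∃ a ∈ S₁, ‖x - a‖ ≤ r * r

namespace IsCloseToTube

variable {m n : ℕ} {α R L d ε δ r : ℝ} {Λ : ℝ≥0} {S₁ S₂ : Set (Euc n)}
  {Φ : Euc n → Euc n →L[ℝ] Euc n}

theorem mem_normalTube (h : IsCloseToTube m α R L d ε Λ δ r S₁ S₂ Φ) {x : Euc n} (hx : x ∈ S₂) :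
    x ∈ normalTube δ S₁ Φ := by
  obtain ⟨a, ha, hxa⟩ := h.near' x hx
  refine h.ball_subset_normalTube ha ?_
  rw [mem_ball, dist_eq_norm]
  linarith [h.sq_le, h.δ_pos]

theorem tubeProj_mem (h : IsCloseToTube m α R L d ε Λ δ r S₁ S₂ Φ) {x : Euc n} (hx : x ∈ S₂) :
    tubeProj δ S₁ Φ x ∈ S₁ :=
  (tubeProj_mem_normalNhd (h.mem_normalTube hx)).1

theorem norm_sub_tubeProj_le_mul (h : IsCloseToTube m α R L d ε Λ δ r S₁ S₂ Φ) {x : Euc n}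
    (hx : x ∈ S₂) : ‖x - tubeProj δ S₁ Φ x‖ ≤ 104 / 100 * (r * r) := by
  obtain ⟨a, ha, hxa⟩ := h.near' x hx
  have := h.norm_sub_tubeProj_le ha (h.mem_normalTube hx) (by linarith [h.sq_le, h.δ_pos])
  linarith

theorem norm_tangent_sub_le (h : IsCloseToTube m α R L d ε Λ δ r S₁ S₂ Φ) {x z : Euc n}
    (hx : x ∈ S₂) (hz : z ∈ tangentPlane S₂ x) :
    ‖z - (tangentPlane S₁ (tubeProj δ S₁ Φ x)).starProjection z‖ ≤ 1 / 1000 * ‖z‖ := by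
  refine h.patch.norm_tangent_sub_le h.patch' h.L_pos h.α_pos h.α_le h.r_pos h.r_le_R
    h.holder_r_le h.r_le h.near' hx (h.tubeProj_mem hx) ?_ hz
  nlinarith [h.norm_sub_tubeProj_le_mul hx, h.r_pos]

/-- The comparison of tangent planes is symmetric in the two submanifolds, so the reverse inclusion
needs no dimension count. -/
theorem norm_tangent_sub_le' (h : IsCloseToTube m α R L d ε Λ δ r S₁ S₂ Φ) {x z : Euc n}
    (hx : x ∈ S₂) (hz : z ∈ tangentPlane S₁ (tubeProj δ S₁ Φ x)) :
    ‖z - (tangentPlane S₂ x).starProjection z‖ ≤ 1 / 1000 * ‖z‖ := by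
  refine h.patch'.norm_tangent_sub_le h.patch h.L_pos h.α_pos h.α_le h.r_pos h.r_le_R
    h.holder_r_le h.r_le h.near (h.tubeProj_mem hx) hx ?_ hz
  rw [norm_sub_rev]
  nlinarith [h.norm_sub_tubeProj_le_mul hx, h.r_pos]

/-- The fibre component varies slowly along `S₂`. -/
theorem norm_fibre_sub_le (h : IsCloseToTube m α R L d ε Λ δ r S₁ S₂ Φ) {x y : Euc n}
    (hx : x ∈ S₂) (hy : y ∈ S₂) (hxy : ‖y - x‖ ≤ δ) :
    ‖(y - tubeProj δ S₁ Φ y) - (x - tubeProj δ S₁ Φ x)‖ ≤ 6 / 100 * ‖y - x‖ := by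
  have h1 := h.norm_tubeProj_sub_le (h.mem_normalTube hx) (h.mem_normalTube hy) hxy
  set T := tangentPlane S₁ (tubeProj δ S₁ Φ x) with hT
  set T' := tangentPlane S₂ x with hT'
  set z := y - x with hz
  set z' := T'.starProjection z with hz'
  have hδ := h.δ_pos
  have hL := h.L_pos
  have hα := h.α_pos
  have h2 : ‖z - z'‖ ≤ ε * ‖z‖ := by
    refine (h.patch'.norm_orthogonal_sub_le hL hα hx hy (by linarith [h.δ_le_R])).trans ?_
    gcongr
    refine le_trans ?_ h.holder_le
    gcongr
    linarith
  have h3 : ‖z' - T.starProjection z'‖ ≤ 1 / 1000 * ‖z'‖ :=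
    h.norm_tangent_sub_le hx (T'.starProjection_apply_mem z)
  have h4 : ‖z'‖ ≤ ‖z‖ := Submodule.norm_starProjection_apply_le _ _
  have h5 := T.norm_sub_starProjection_le_norm (z - z')
  -- The three errors are the angle between the planes, the deviation of `S₂` from its own tangent
  -- plane, and the foot point estimate: `1 / 1000 + ε + 4 ε < 6 / 100`.
  have e : (y - tubeProj δ S₁ Φ y) - (x - tubeProj δ S₁ Φ x)
      = (z' - T.starProjection z') + ((z - z') - T.starProjection (z - z'))
        - (tubeProj δ S₁ Φ y - tubeProj δ S₁ Φ x - T.starProjection z) := by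
    rw [map_sub, hz]; abel
  rw [e]
  have h6 := norm_sub_le ((z' - T.starProjection z') + ((z - z') - T.starProjection (z - z')))
    (tubeProj δ S₁ Φ y - tubeProj δ S₁ Φ x - T.starProjection z)
  have h7 := norm_add_le (z' - T.starProjection z') ((z - z') - T.starProjection (z - z'))
  nlinarith [h.ε_lt, norm_nonneg z]

/-- A rough bound that brings points with nearby feet within range of `norm_fibre_sub_le`. Each
fibre component is at most `104 / 100 * (δ / 8) = 13 / 100 * δ`. -/
theorem norm_sub_le_of_tubeProj (h : IsCloseToTube m α R L d ε Λ δ r S₁ S₂ Φ) {x y : Euc n}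
    (hx : x ∈ S₂) (hy : y ∈ S₂) :
    ‖y - x‖ ≤ ‖tubeProj δ S₁ Φ y - tubeProj δ S₁ Φ x‖ + 26 / 100 * δ := by
  have h1 := h.norm_sub_tubeProj_le_mul hx
  have h2 := h.norm_sub_tubeProj_le_mul hy
  have e : y - x = (tubeProj δ S₁ Φ y - tubeProj δ S₁ Φ x) + (y - tubeProj δ S₁ Φ y)
      - (x - tubeProj δ S₁ Φ x) := by abel
  have h3 := norm_sub_le ((tubeProj δ S₁ Φ y - tubeProj δ S₁ Φ x) + (y - tubeProj δ S₁ Φ y))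
    (x - tubeProj δ S₁ Φ x)
  have h4 := norm_add_le (tubeProj δ S₁ Φ y - tubeProj δ S₁ Φ x) (y - tubeProj δ S₁ Φ y)
  rw [← e] at h3
  linarith [h.sq_le]

/-- If the feet agree, the difference of the points equals the difference of their fibre components,
which is at most `6 / 100` of itself. -/
theorem injOn_tubeProj (h : IsCloseToTube m α R L d ε Λ δ r S₁ S₂ Φ) :
    InjOn (tubeProj δ S₁ Φ) S₂ := by
  intro x hx y hy hxy
  have h1 := h.norm_sub_le_of_tubeProj hx hy
  rw [hxy, sub_self, norm_zero] at h1
  have h2 := h.norm_fibre_sub_le hx hy (by linarith [h.δ_pos])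
  rw [hxy, sub_sub_sub_cancel_right] at h2
  have h3 : ‖y - x‖ ≤ 0 := by linarith [norm_nonneg (y - x)]
  exact (sub_eq_zero.1 (norm_le_zero_iff.1 h3)).symm

/-- The foot point map from `S₂` to `S₁` has local inverses of class `C¹`. -/
theorem exists_local_section (h : IsCloseToTube m α R L d ε Λ δ r S₁ S₂ Φ) {x : Euc n}
    (hx : x ∈ S₂) :
    ∃ σ : Euc n → Euc n, ContDiffAt ℝ 1 σ (tubeProj δ S₁ Φ x) ∧
      ∀ᶠ a in 𝓝 (tubeProj δ S₁ Φ x), a ∈ S₁ → σ a ∈ S₂ ∧ tubeProj δ S₁ Φ (σ a) = a := by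
  obtain ⟨X, hX, hX0, hX', hXS, -, -, -⟩ := h.patch'.exists_chart h.L_pos h.α_pos hx
  have hxt := h.mem_normalTube hx
  set π := tubeProj δ S₁ Φ with hπdef
  set T := tangentPlane S₁ (π x) with hT
  set T' := tangentPlane S₂ x with hT'
  have hπ : ContDiffAt ℝ 1 π (X 0) := by rw [hX0]; exact h.contDiffAt_tubeProj hxt
  have hψ : ContDiffAt ℝ 1 (fun y => π (X y)) 0 := hπ.comp 0 hX.contDiffAt
  have hπ' : HasFDerivAt π (fderiv ℝ π x) (X 0) := by
    rw [hX0] at hπ ⊢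
    exact (hπ.differentiableAt one_ne_zero).hasFDerivAt
  have hψ' : HasFDerivAt (fun y => π (X y)) ((fderiv ℝ π x).comp T'.starProjection) 0 :=
    hπ'.comp 0 hX'
  have hR : 0 < R := by linarith [h.r_pos, h.r_le_R]
  have hsmall : ∀ᶠ y in 𝓝 (0 : Euc n), X y ∈ S₂ := by
    filter_upwards [ball_mem_nhds (0 : Euc n) (half_pos hR)] with y hy
    exact hXS y (by simpa using hy)
  have hnorm : ‖fderiv ℝ π x - T.starProjection‖ ≤ 4 * ε := by
    rw [hX0] at hπ'
    refine (hπ'.sub T.starProjection.hasFDerivAt).le_of_lip' (by linarith [h.ε_pos]) ?_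
    filter_upwards [h.isOpen_normalTube.mem_nhds hxt, closedBall_mem_nhds x h.δ_pos] with y hy hyx
    have := h.norm_tubeProj_sub_le hxt hy (by simpa [dist_eq_norm] using hyx)
    rw [map_sub] at this
    change ‖(π y - T.starProjection y) - (π x - T.starProjection x)‖ ≤ _
    convert this using 2
    abel
  -- The fibration is centred at the zero fibre vector, so `K` is defined near `π x` itself. For `a
  -- ∈ S₁` it gives `π (X (K a)) = π a = a`, so `X ∘ K` is a section. The derivative of `π ∘ X`
  -- differs from `T` by at most `4 ε + 1 / 1000`.
  obtain ⟨K, hK, hK0, hKe⟩ := h.exists_local_fibration (ψ := fun y => π (X y)) (y₀ := 0) hψ hψ'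
    (hsmall.mono fun y hy => h.tubeProj_mem hy) (map_zero _) (by simpa using h.δ_pos) (by
      rw [hX0]
      refine ContinuousLinearMap.opNorm_le_bound _ (by norm_num) fun z => ?_
      have e : ((fderiv ℝ π x).comp T'.starProjection - T.starProjection) z
          = (fderiv ℝ π x - T.starProjection) (T'.starProjection z)
            - T.starProjection (z - T'.starProjection z) := by
        simp only [sub_apply, ContinuousLinearMap.comp_apply, map_sub]
        abel
      rw [e]
      have h1 := ContinuousLinearMap.le_of_opNorm_le _ hnorm (T'.starProjection z)
      have h2 : ‖T'.starProjection z‖ ≤ ‖z‖ := Submodule.norm_starProjection_apply_le _ _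
      have h3 := Submodule.norm_starProjection_sub_le (by norm_num)
        (fun z (hz : z ∈ T) => h.norm_tangent_sub_le' hx hz) z
      have h4 := norm_sub_le ((fderiv ℝ π x - T.starProjection) (T'.starProjection z))
        (T.starProjection (z - T'.starProjection z))
      nlinarith [h.ε_lt, h.ε_pos, norm_nonneg z, norm_nonneg (T'.starProjection z)])
  rw [hX0, add_zero] at hK hK0 hKe
  refine ⟨fun a => X (K a), hX.contDiffAt.comp _ hK, ?_⟩
  have hKt : Filter.Tendsto K (𝓝 (π x)) (𝓝 0) := by
    have := hK.continuousAt.tendsto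
    rwa [hK0] at this
  filter_upwards [hKe, hKt.eventually hsmall] with a ha haS haS₁
  exact ⟨haS, by rw [← ha.2]; exact h.tubeProj_self haS₁⟩

theorem isClosed_image (h : IsCloseToTube m α R L d ε Λ δ r S₁ S₂ Φ) :
    IsClosed (tubeProj δ S₁ Φ '' S₂) := by
  refine (h.patch'.submanifold.1.image_of_continuousOn fun x hx => ?_).isClosed
  exact (h.contDiffAt_tubeProj (h.mem_normalTube hx)).continuousAt.continuousWithinAt

/-- Local sections make the image open in `S₁`, compactness makes it closed. Every `a ∈ S₁` is
joined inside a graph patch to a point of the image, so connectedness is needed only along that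
path. -/
theorem image_tubeProj (h : IsCloseToTube m α R L d ε Λ δ r S₁ S₂ Φ) :
    tubeProj δ S₁ Φ '' S₂ = S₁ := by
  refine Subset.antisymm (image_subset_iff.2 fun x hx => h.tubeProj_mem hx) fun a ha => ?_
  obtain ⟨x, hx, hax⟩ := h.near a ha
  set b := tubeProj δ S₁ Φ x with hb
  have hbS : b ∈ S₁ := h.tubeProj_mem hx
  have hδ := h.δ_pos
  have hab : ‖b - a‖ < R / 2 := by
    have h1 := h.norm_sub_tubeProj_le_mul hx
    have e : b - a = -(a - x) - (x - b) := by abel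
    rw [e]
    have h2 := norm_sub_le (-(a - x)) (x - b)
    rw [norm_neg] at h2
    nlinarith [h.sq_le, h.δ_le_R]
  obtain ⟨X, hX, hX0, -, hXS, hXb, -, -⟩ := h.patch.exists_chart h.L_pos h.α_pos ha
  have hR : 0 < R := by linarith [h.r_pos, h.r_le_R]
  set γ : ℝ → Euc n := fun t => X (t • (b - a)) with hγ
  have hγc : Continuous γ := hX.continuous.comp (by fun_prop)
  have hγS : ∀ t ∈ Icc (0 : ℝ) 1, γ t ∈ S₁ := by
    intro t ht
    refine hXS _ ?_
    rw [norm_smul, Real.norm_of_nonneg ht.1]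
    nlinarith [ht.2, norm_nonneg (b - a)]
  have hγ1 : γ 1 = b := by
    simp only [hγ, one_smul]
    exact hXb b hbS (by linarith)
  have hγ0 : γ 0 = a := by simp only [hγ, zero_smul, hX0]
  have hpre : IsPreconnected (γ '' Icc 0 1) := isPreconnected_Icc.image _ hγc.continuousOn
  set I := tubeProj δ S₁ Φ '' S₂ with hI
  -- Relative openness of `I` in `S₁`, witnessed by an open set of the ambient space.
  obtain ⟨O, hO, hOI⟩ : ∃ O : Set (Euc n), IsOpen O ∧ I = O ∩ S₁ := by
    refine ⟨interior {a | a ∈ S₁ → a ∈ I}, isOpen_interior, ?_⟩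
    ext c
    constructor
    · rintro ⟨y, hy, rfl⟩
      refine ⟨?_, h.tubeProj_mem hy⟩
      rw [mem_interior_iff_mem_nhds]
      obtain ⟨σ, -, hσ⟩ := h.exists_local_section hy
      exact hσ.mono fun c hc hcS => ⟨σ c, hc hcS⟩
    · rintro ⟨hc, hcS⟩
      exact interior_subset hc hcS
  have hsub : γ '' Icc 0 1 ⊆ I := by
    intro c hc
    by_contra hcI
    have hcov : γ '' Icc 0 1 ⊆ O ∪ Iᶜ := by
      intro e he
      by_cases heI : e ∈ I
      · exact Or.inl (hOI ▸ heI : e ∈ O ∩ S₁).1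
      · exact Or.inr heI
    have hbI : b ∈ O ∩ S₁ := hOI ▸ mem_image_of_mem _ hx
    obtain ⟨e, ⟨t, ht, rfl⟩, heO, heI⟩ := hpre O Iᶜ hO h.isClosed_image.isOpen_compl hcov
      ⟨b, ⟨1, by simp, hγ1⟩, hbI.1⟩ ⟨c, hc, hcI⟩
    exact heI (hOI ▸ ⟨heO, hγS t ht⟩)
  exact hsub ⟨0, by simp, hγ0⟩

end IsCloseToTube

/-! ### Cutoff, vector field and isotopy -/

theorem hasDerivAt_sq_posPart (x : ℝ) :
    HasDerivAt (fun x : ℝ => (max 0 x) ^ 2) (2 * max 0 x) x := by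
  rcases lt_trichotomy x 0 with hx | rfl | hx
  · rw [max_eq_left hx.le, mul_zero]
    refine (hasDerivAt_const x (0 : ℝ)).congr_of_eventuallyEq ?_
    filter_upwards [gt_mem_nhds hx] with y hy
    simp [max_eq_left hy.le]
  · rw [max_self, mul_zero, hasDerivAt_iff_isLittleO_nhds_zero]
    simp only [zero_add, max_self, smul_zero, sub_zero]
    have h1 : (fun h : ℝ => (max 0 h) ^ 2 - 0 ^ 2) =O[𝓝 0] fun h : ℝ => h ^ 2 := by
      refine Asymptotics.isBigO_of_le _ fun h => ?_
      rcases le_total h 0 with hh | hh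
      · simp [max_eq_left hh]
        positivity
      · simp [max_eq_right hh]
    exact h1.trans_isLittleO (Asymptotics.isLittleO_pow_id one_lt_two)
  · rw [max_eq_right hx.le]
    refine HasDerivAt.congr_of_eventuallyEq (f := fun x => x ^ 2)
      (by simpa using hasDerivAt_pow 2 x) ?_
    filter_upwards [lt_mem_nhds hx] with y hy
    simp [max_eq_right hy.le]

theorem contDiff_sq_posPart : ContDiff ℝ 1 fun x : ℝ => (max 0 x) ^ 2 := by
  refine contDiff_one_iff_deriv.2 ⟨fun x => (hasDerivAt_sq_posPart x).differentiableAt, ?_⟩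
  rw [show deriv (fun x : ℝ => (max 0 x) ^ 2) = fun x => 2 * max 0 x from
    funext fun x => (hasDerivAt_sq_posPart x).deriv]
  fun_prop

/-- A cutoff function of class `C¹` that is `1` on `(-∞, 1/50]` and `0` on `[23/25, ∞)`. -/
def cutoff (τ : ℝ) : ℝ := (max 0 (1 - 81 / 64 * (max 0 (τ - 1 / 50)) ^ 2)) ^ 2

theorem contDiff_cutoff : ContDiff ℝ 1 cutoff := by
  have h1 : ContDiff ℝ 1 fun τ : ℝ => (max 0 (τ - 1 / 50)) ^ 2 :=
    contDiff_sq_posPart.comp (contDiff_id.sub contDiff_const)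
  exact contDiff_sq_posPart.comp (contDiff_const.sub (contDiff_const.mul h1))

theorem cutoff_eq_one {τ : ℝ} (h : τ ≤ 1 / 50) : cutoff τ = 1 := by
  rw [cutoff, max_eq_left (sub_nonpos.2 h)]
  norm_num

theorem cutoff_eq_zero {τ : ℝ} (h : 23 / 25 ≤ τ) : cutoff τ = 0 := by
  rw [cutoff, max_eq_right (by linarith : 0 ≤ τ - 1 / 50), max_eq_left (by nlinarith)]
  norm_num

theorem abs_cutoff_le_one (τ : ℝ) : |cutoff τ| ≤ 1 := by
  have h0 : 0 ≤ cutoff τ := sq_nonneg _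
  rw [abs_of_nonneg h0, cutoff]
  refine pow_le_one₀ (le_max_left _ _) (max_le zero_le_one ?_)
  nlinarith [sq_nonneg (max 0 (τ - 1 / 50))]

/-- With `s = 9 k / 8`, where `k` is the positive part of `τ - 1 / 50`, the slope is `9 / 2 * s * (1
- s ^ 2)` in absolute value for `s ≤ 1`. Its maximum is `√3 < 9 / 5`. -/
theorem abs_cutoff_sub_le (τ τ' : ℝ) : |cutoff τ' - cutoff τ| ≤ 9 / 5 * |τ' - τ| := by
  have hd : ∀ x, HasDerivAt cutoff
      (2 * max 0 (1 - 81 / 64 * (max 0 (x - 1 / 50)) ^ 2)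
        * (-(81 / 64 * (2 * max 0 (x - 1 / 50))))) x := by
    intro x
    have h1 : HasDerivAt (fun τ : ℝ => (max 0 (τ - 1 / 50)) ^ 2) (2 * max 0 (x - 1 / 50)) x := by
      have := (hasDerivAt_sq_posPart (x - 1 / 50)).comp x ((hasDerivAt_id x).sub_const (1 / 50))
      rwa [mul_one] at this
    have h2 := (h1.const_mul (81 / 64)).const_sub 1
    exact (hasDerivAt_sq_posPart _).comp x h2
  have := convex_univ.norm_image_sub_le_of_norm_hasDerivWithin_le (C := 9 / 5)
    (fun x _ => (hd x).hasDerivWithinAt) (fun x _ => ?_) (mem_univ τ) (mem_univ τ')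
  · simpa [Real.norm_eq_abs] using this
  · set k := max 0 (x - 1 / 50) with hk
    have hk0 : 0 ≤ k := le_max_left _ _
    rw [Real.norm_eq_abs, abs_mul, abs_neg, abs_of_nonneg (by positivity),
      abs_of_nonneg (by positivity)]
    rcases le_total (1 - 81 / 64 * k ^ 2) 0 with h | h
    · rw [max_eq_left h]; norm_num
    · rw [max_eq_right h]
      -- The maximum is attained at `k = 8 / (9 √3)`, close to `1 / 2`, whence the squares of `k - 1
      -- / 2`.
      nlinarith [mul_nonneg (by linarith : (0 : ℝ) ≤ k + 1) (sq_nonneg (k - 1 / 2)),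
        mul_nonneg hk0 (sq_nonneg (k - 1 / 2)), sq_nonneg (k - 1 / 2)]

/-- A `C¹` perturbation of the identity with derivative of norm at most `c < 1` is a
diffeomorphism. -/
theorem exists_inverse_id_sub {n : ℕ} {f : Euc n → Euc n} {c : ℝ≥0} (hc : c < 1)
    (hf : ContDiff ℝ 1 f) (hf' : ∀ x, ‖fderiv ℝ f x‖ ≤ c) :
    ∃ g : Euc n → Euc n, ContDiff ℝ 1 g ∧ Function.LeftInverse g (fun x => x - f x) ∧
      Function.RightInverse g (fun x => x - f x) := by
  have hdiff : Differentiable ℝ f := hf.differentiable one_ne_zero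
  have hlip : LipschitzWith c f := lipschitzWith_of_nnnorm_fderiv_le hdiff hf'
  have happ : ApproximatesLinearOn (fun x => x - f x)
      ((ContinuousLinearEquiv.refl ℝ (Euc n) : Euc n ≃L[ℝ] Euc n) : Euc n →L[ℝ] Euc n) univ c := by
    intro x _ y _
    have h1 := hlip.dist_le_mul x y
    rw [dist_eq_norm, dist_eq_norm] at h1
    have e : (x - f x) - (y - f y) - (x - y) = -(f x - f y) := by abel
    change ‖(x - f x) - (y - f y) - (x - y)‖ ≤ _
    rwa [e, norm_neg]
  have hcN : Subsingleton (Euc n) ∨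
      c < ‖((ContinuousLinearEquiv.refl ℝ (Euc n)).symm : Euc n →L[ℝ] Euc n)‖₊⁻¹ := by
    rcases subsingleton_or_nontrivial (Euc n) with h | h
    · exact Or.inl h
    · right
      have : ((ContinuousLinearEquiv.refl ℝ (Euc n)).symm : Euc n →L[ℝ] Euc n)
        = ContinuousLinearMap.id ℝ (Euc n) := rfl
      rw [this]
      have h1 : ‖ContinuousLinearMap.id ℝ (Euc n)‖₊ = 1 := by
        ext; exact ContinuousLinearMap.norm_id
      rwa [h1, inv_one]
  let e := happ.toHomeomorph _ hcN
  have hsmall : ∀ x, ‖fderiv ℝ f x‖ < 1 := fun x => (hf' x).trans_lt (by exact_mod_cast hc)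
  refine ⟨e.symm, ?_, e.left_inv, e.right_inv⟩
  refine e.contDiff_symm
    (f₀' := fun x => ContinuousLinearEquiv.ofUnit (Units.oneSub (fderiv ℝ f x) (hsmall x)))
    (fun x => ?_) (contDiff_id.sub hf)
  exact (hasFDerivAt_id x).sub (hdiff x).hasFDerivAt

namespace IsCloseToTube

variable {m n : ℕ} {α R L d ε δ r : ℝ} {Λ : ℝ≥0} {S₁ S₂ : Set (Euc n)}
  {Φ : Euc n → Euc n →L[ℝ] Euc n}

/-- The inverse of the foot point map from `S₂` to `S₁`. -/
theorem exists_section (h : IsCloseToTube m α R L d ε Λ δ r S₁ S₂ Φ) :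
    ∃ σ : Euc n → Euc n, (∀ a ∈ S₁, σ a ∈ S₂ ∧ tubeProj δ S₁ Φ (σ a) = a) ∧
      (∀ x ∈ S₂, σ (tubeProj δ S₁ Φ x) = x) ∧
      ∀ x ∈ normalTube δ S₁ Φ, ContDiffAt ℝ 1 (fun y => σ (tubeProj δ S₁ Φ y)) x := by
  have hsurj : ∀ a ∈ S₁, ∃ x ∈ S₂, tubeProj δ S₁ Φ x = a := fun a ha => by
    rwa [← h.image_tubeProj] at ha
  choose! σ hσS hσ using hsurj
  refine ⟨σ, fun a ha => ⟨hσS a ha, hσ a ha⟩, fun x hx => ?_, fun x hx => ?_⟩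
  · exact h.injOn_tubeProj (hσS _ (h.tubeProj_mem hx)) hx (hσ _ (h.tubeProj_mem hx))
  · have ha := (tubeProj_mem_normalNhd hx).1
    obtain ⟨τ, hτ, hτe⟩ := h.exists_local_section (hσS _ ha)
    rw [hσ _ ha] at hτ hτe
    have hπ := h.contDiffAt_tubeProj hx
    -- `σ` is chosen pointwise; by injectivity of the foot point map on `S₂` it agrees on `S₁` with
    -- the `C¹` local section.
    refine (hτ.comp x hπ).congr_of_eventuallyEq ?_
    filter_upwards [h.isOpen_normalTube.mem_nhds hx, hπ.continuousAt.eventually hτe] with y hy hyτ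
    have hyS := (tubeProj_mem_normalNhd hy).1
    exact h.injOn_tubeProj (hσS _ hyS) (hyτ hyS).1 ((hσ _ hyS).trans (hyτ hyS).2.symm)

/-- There is a vector field on the whole space with derivative of norm less than `1` that is, on
`S₂`, the fibre component. -/
theorem exists_vectorField (h : IsCloseToTube m α R L d ε Λ δ r S₁ S₂ Φ) :
    ∃ g : Euc n → Euc n, ContDiff ℝ 1 g ∧ (∀ x, ‖fderiv ℝ g x‖ ≤ 3 / 5) ∧
      ∀ x ∈ S₂, g x = x - tubeProj δ S₁ Φ x := by
  classical
  obtain ⟨σ, hσS, hσπ, hσC⟩ := h.exists_section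
  set π := tubeProj δ S₁ Φ with hπ
  set U := normalTube δ S₁ Φ with hU
  have hδ := h.δ_pos
  have hUo : IsOpen U := h.isOpen_normalTube
  have hπS : ∀ x ∈ U, π x ∈ S₁ := fun x hx => (tubeProj_mem_normalNhd hx).1
  -- The displacement depends only on the foot, so it varies slowly; the squared norm keeps the
  -- cutoff `C¹` also on `S₁`.
  set g₀ : Euc n → Euc n := fun x => cutoff (‖x - π x‖ ^ 2 / δ ^ 2) • (σ (π x) - π x) with hg₀
  set g : Euc n → Euc n := fun x => if x ∈ U then g₀ x else 0 with hg
  have hgU : ∀ x ∈ U, g =ᶠ[𝓝 x] g₀ := fun x hx => by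
    filter_upwards [hUo.mem_nhds hx] with y hy
    simp [hg, hy]
  have hgC : ∀ x ∈ U, ContDiffAt ℝ 1 g x := by
    intro x hx
    refine ContDiffAt.congr_of_eventuallyEq ?_ (hgU x hx)
    have hπx : ContDiffAt ℝ 1 π x := h.contDiffAt_tubeProj hx
    have h1 : ContDiffAt ℝ 1 (fun y => ‖y - π y‖ ^ 2 / δ ^ 2) x :=
      ((contDiffAt_id.sub hπx).norm_sq ℝ).div_const _
    exact (contDiff_cutoff.contDiffAt.comp x h1).smul ((hσC x hx).sub hπx)
  have hg0 : ∀ x, x ∉ U → g =ᶠ[𝓝 x] fun _ => 0 := by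
    intro x hx
    -- Beyond fibre length `24 / 25 * δ` the cutoff vanishes, as `(24 / 25) ^ 2 > 23 / 25`; that
    -- this shorter tube is closed makes the extension by zero smooth across the boundary.
    have hcl := h.isClosed_tube (24 / 25 * δ)
    have hxK : x ∈ {x | ∃ a ∈ S₁, ∃ v, Φ a v = v ∧ ‖v‖ ≤ 24 / 25 * δ ∧ a + v = x}ᶜ := by
      rintro ⟨a, ha, v, hv, hvδ, rfl⟩
      exact hx ⟨(a, v), ⟨ha, hv, by dsimp only; linarith⟩, rfl⟩
    filter_upwards [hcl.isOpen_compl.mem_nhds hxK] with y hy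
    by_cases hyU : y ∈ U
    · have hyN := tubeProj_mem_normalNhd hyU
      have hlt : 24 / 25 * δ < ‖y - π y‖ := by
        by_contra hcon
        exact hy ⟨π y, hyN.1, y - π y, hyN.2.1, not_lt.1 hcon, add_sub_cancel _ _⟩
      have h2 : 23 / 25 ≤ ‖y - π y‖ ^ 2 / δ ^ 2 := by
        rw [le_div_iff₀ (by positivity)]
        nlinarith
      simp [hg, hyU, hg₀, cutoff_eq_zero h2]
    · simp [hg, hyU]
  refine ⟨g, contDiff_iff_contDiffAt.2 fun x => ?_, fun x => ?_, fun x hx => ?_⟩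
  · by_cases hx : x ∈ U
    · exact hgC x hx
    · exact contDiffAt_const.congr_of_eventuallyEq (hg0 x hx)
  · by_cases hx : x ∈ U
    · refine norm_fderiv_le_of_lip' ℝ (by norm_num) ?_
      filter_upwards [hUo.mem_nhds hx, closedBall_mem_nhds x (half_pos hδ)] with y hy hyx
      rw [mem_closedBall, dist_eq_norm] at hyx
      have hgx : g x = g₀ x := if_pos hx
      have hgy : g y = g₀ y := if_pos hy
      rw [hgx, hgy]
      obtain ⟨hxσ, hxσπ⟩ := hσS _ (hπS x hx)
      obtain ⟨hyσ, hyσπ⟩ := hσS _ (hπS y hy)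
      have hsx := h.norm_sub_tubeProj_le_mul hxσ
      have hd := h.norm_sub_le_of_tubeProj hxσ hyσ
      have hπxy := h.norm_tubeProj_sub_tubeProj_le hx hy (by linarith)
      have hvxy := h.norm_sub_tubeProj_sub_le hx hy (by linarith)
      rw [← hπ] at hd hsx hπxy hvxy
      rw [hxσπ, hyσπ] at hd
      rw [hxσπ] at hsx
      have hs := h.norm_fibre_sub_le hxσ hyσ (by linarith)
      rw [← hπ, hxσπ, hyσπ] at hs
      set sx := σ (π x) - π x with hsxd
      set sy := σ (π y) - π y with hsyd
      have hσxy : ‖σ (π y) - σ (π x)‖ ≤ ‖π y - π x‖ + ‖sy - sx‖ := by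
        have e : σ (π y) - σ (π x) = (π y - π x) + (sy - sx) := by rw [hsxd, hsyd]; abel
        rw [e]; exact norm_add_le _ _
      -- `sy - sx` occurs on both sides: `‖sy - sx‖ ≤ 6 / 100 * (104 / 100 * ‖y - x‖ + ‖sy - sx‖)`.
      have hs' : ‖sy - sx‖ ≤ 7 / 100 * ‖y - x‖ := by linarith [norm_nonneg (y - x)]
      have hvx : ‖x - π x‖ ≤ δ := (tubeProj_mem_normalNhd hx).2.2.le
      have hvy : ‖y - π y‖ ≤ δ := (tubeProj_mem_normalNhd hy).2.2.le
      have hτ : |‖y - π y‖ ^ 2 / δ ^ 2 - ‖x - π x‖ ^ 2 / δ ^ 2| ≤ 208 / 100 * ‖y - x‖ / δ := by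
        have h1 : |‖y - π y‖ - ‖x - π x‖| ≤ 104 / 100 * ‖y - x‖ :=
          (abs_norm_sub_norm_le _ _).trans hvxy
        rw [← sub_div, abs_div, abs_of_pos (by positivity : 0 < δ ^ 2), div_le_div_iff₀
          (by positivity) hδ, sq_sub_sq, abs_mul, abs_of_nonneg (by positivity)]
        have h2 : ‖y - π y‖ + ‖x - π x‖ ≤ 2 * δ := by linarith
        calc (‖y - π y‖ + ‖x - π x‖) * |‖y - π y‖ - ‖x - π x‖| * δ
            ≤ (2 * δ) * (104 / 100 * ‖y - x‖) * δ := by gcongr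
          _ = 208 / 100 * ‖y - x‖ * δ ^ 2 := by ring
      set cx := cutoff (‖x - π x‖ ^ 2 / δ ^ 2) with hcx
      set cy := cutoff (‖y - π y‖ ^ 2 / δ ^ 2) with hcy
      have hc : |cy - cx| ≤ 9 / 5 * (208 / 100 * ‖y - x‖ / δ) :=
        (abs_cutoff_sub_le _ _).trans (by gcongr)
      have hcy1 : |cy| ≤ 1 := abs_cutoff_le_one _
      have e : cy • sy - cx • sx = cy • (sy - sx) + (cy - cx) • sx := by
        rw [smul_sub cy sy sx, sub_smul]; abel
      have hsx' : ‖sx‖ ≤ 13 / 100 * δ := by linarith [h.sq_le]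
      have h1 : ‖(cy - cx) • sx‖ ≤ 49 / 100 * ‖y - x‖ := by
        rw [norm_smul, Real.norm_eq_abs]
        calc |cy - cx| * ‖sx‖ ≤ (9 / 5 * (208 / 100 * ‖y - x‖ / δ)) * (13 / 100 * δ) := by gcongr
          _ = 9 / 5 * (208 / 100) * (13 / 100) * ‖y - x‖ := by field_simp
          _ ≤ 49 / 100 * ‖y - x‖ := by gcongr; norm_num
      have h2 : ‖cy • (sy - sx)‖ ≤ 7 / 100 * ‖y - x‖ := by
        rw [norm_smul, Real.norm_eq_abs]
        calc |cy| * ‖sy - sx‖ ≤ 1 * (7 / 100 * ‖y - x‖) := by gcongr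
          _ = _ := one_mul _
      change ‖cy • sy - cx • sx‖ ≤ _
      rw [e]
      linarith [norm_add_le (cy • (sy - sx)) ((cy - cx) • sx), norm_nonneg (y - x)]
    · rw [(hg0 x hx).fderiv_eq, fderiv_fun_const]
      simp only [Pi.zero_apply, norm_zero]
      norm_num
  · have hxU := h.mem_normalTube hx
    have h1 := h.norm_sub_tubeProj_le_mul hx
    have h2 : ‖x - π x‖ ^ 2 / δ ^ 2 ≤ 1 / 50 := by
      have h3 : ‖x - π x‖ ≤ 13 / 100 * δ := by linarith [h.sq_le]
      rw [div_le_iff₀ (by positivity)]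
      nlinarith [norm_nonneg (x - π x)]
    have hgx : g x = g₀ x := if_pos hxU
    rw [hgx]
    simp only [hg₀]
    rw [cutoff_eq_one h2, one_smul, hσπ x hx]

/-- The isotopy is affine in `t`, and `(1 - t) • g` has derivative at most `3 / 5`. At points of
`S₂` it moves along the segment from `π x` to `x`. -/
theorem exists_isotopy (h : IsCloseToTube m α R L d ε Λ δ r S₁ S₂ Φ) :
    ∃ H : Euc n → ℝ → Euc n, IsC1AmbientIsotopy H S₁ S₂ ∧ ContractsAlongFibres H δ S₁ S₂ Φ := by
  obtain ⟨g, hg, hg', hgS⟩ := h.exists_vectorField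
  refine ⟨fun x t => x - (1 - t) • g x, ⟨?_, fun t ht => ?_, fun x => by simp, ?_⟩,
    fun x hx => ?_⟩
  · refine ContDiff.contDiffOn ?_
    exact contDiff_fst.sub ((contDiff_const.sub contDiff_snd).smul (hg.comp contDiff_fst))
  · refine exists_inverse_id_sub (c := 3 / 5) (f := fun x => (1 - t) • g x) ?_
      (hg.const_smul _) fun x => ?_
    · rw [div_lt_one (by norm_num)]; norm_num
    · rw [fderiv_fun_const_smul (hg.differentiable one_ne_zero x), norm_smul,
        Real.norm_of_nonneg (by linarith [ht.2])]
      have := hg' x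
      push_cast
      nlinarith [ht.1, ht.2, norm_nonneg (fderiv ℝ g x)]
  · rw [← h.image_tubeProj]
    refine image_congr fun x hx => ?_
    simp [hgS x hx]
  · have hxN := tubeProj_mem_normalNhd (h.mem_normalTube hx)
    refine ⟨_, hxN, add_sub_cancel _ _, fun q hq hqx => ?_, fun t _ => ?_⟩
    · exact h.eq_of_add_eq hxN hq (by rw [hqx]; simp)
    · simp only [hgS x hx, sub_smul, one_smul]
      abel

end IsCloseToTube

/-! ### From the threshold to the smallness conditions -/

theorem exists_norm_sub_le_of_infEDist {n : ℕ} {A B : Set (Euc n)} {ρ : ℝ}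
    (h : (⨆ y ∈ A, infEDist y B) < ENNReal.ofReal ρ) {y : Euc n} (hy : y ∈ A) :
    ∃ z ∈ B, ‖y - z‖ ≤ ρ := by
  have h1 : infEDist y B < ENNReal.ofReal ρ :=
    (le_iSup₂ (f := fun y (_ : y ∈ A) => infEDist y B) y hy).trans_lt h
  obtain ⟨z, hz, hyz⟩ := infEDist_lt_iff.1 h1
  refine ⟨z, hz, ?_⟩
  rw [edist_dist, ENNReal.ofReal_lt_ofReal_iff_of_nonneg dist_nonneg, dist_eq_norm] at hyz
  exact hyz.le

theorem isCloseToTube_of_hausdorffSumDist_lt {m n : ℕ} {R L α ε d : ℝ} (hR : 0 < R) (hL : 0 < L)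
    (hα : 0 < α) (hα1 : α ≤ 1) (hε : 0 < ε) (hε1 : ε < 1 / 100) {S₁ S₂ : Set (Euc n)}
    {Φ : Euc n → Euc n →L[ℝ] Euc n} {Λ : ℝ≥0} (h₁ : GraphPatchClass m n α R L d S₁)
    (h₂ : GraphPatchClass m n α R L d S₂) (hΦ : IsNormalMap m ε S₁ Φ) (hΛ : 0 < Λ)
    (hlip : LipschitzOnWith Λ Φ S₁)
    (hd : hausdorffSumDist S₁ S₂ < ENNReal.ofReal (rhoG R L α ε Λ)) :
    IsCloseToTube m α R L d ε Λ (deltaTub R L α ε Λ) (√(rhoG R L α ε Λ)) S₁ S₂ Φ := by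
  have hΛ' : (0 : ℝ) < Λ := hΛ
  set δ := deltaTub R L α ε Λ with hδ
  set ρ := rhoG R L α ε Λ with hρ
  have hδ0 : 0 < δ := by
    rw [hδ, deltaTub]
    have : 0 < (ε / L) ^ (1 / α) := Real.rpow_pos_of_pos (by positivity) _
    refine lt_min (by positivity) (lt_min (by positivity) (lt_min (by positivity) one_pos))
  have hδR : δ ≤ R / 4 := min_le_left _ _
  have hδL : δ ≤ (ε / L) ^ (1 / α) / 4 := (min_le_right _ _).trans (min_le_left _ _)
  have hδΛ : δ ≤ ε / (4 * Λ) :=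
    (min_le_right _ _).trans ((min_le_right _ _).trans (min_le_left _ _))
  have hδ1 : δ ≤ 1 := (min_le_right _ _).trans ((min_le_right _ _).trans (min_le_right _ _))
  -- Positivity comes from the distance hypothesis: nothing lies below `ENNReal.ofReal ρ` if `ρ ≤
  -- 0`.
  have hρ0 : 0 < ρ := by
    by_contra hcon
    rw [ENNReal.ofReal_of_nonpos (not_lt.1 hcon)] at hd
    exact not_lt_zero hd
  have hρδ : ρ ≤ δ / 8 := (min_le_left _ _).trans (min_le_left _ _)
  have hρR : ρ ≤ R ^ 2 / 2 ^ 6 := (min_le_left _ _).trans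
    ((min_le_right _ _).trans ((min_le_right _ _).trans (min_le_left _ _)))
  have hρC : ρ ≤ cLip L Λ ^ (-2 / α) := min_le_right _ _
  set r := √ρ with hr
  have hr0 : 0 < r := Real.sqrt_pos.2 hρ0
  have hrr : r * r = ρ := Real.mul_self_sqrt hρ0.le
  have hr1 : r ≤ 1 := by nlinarith
  have hC : 0 < cLip L Λ := by unfold cLip; positivity
  have hrα : r ^ α * cLip L Λ ≤ 1 := by
    have h1 : r ^ α = ρ ^ (α / 2) := by
      rw [hr, Real.sqrt_eq_rpow, ← Real.rpow_mul hρ0.le]; congr 1; ring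
    have h2 : ρ ^ (α / 2) ≤ (cLip L Λ ^ (-2 / α)) ^ (α / 2) := by gcongr
    have h3 : (cLip L Λ ^ (-2 / α)) ^ (α / 2) = (cLip L Λ)⁻¹ := by
      rw [← Real.rpow_mul hC.le, ← Real.rpow_neg_one]
      congr 1
      field_simp
    rw [h3] at h2
    rw [h1]
    calc ρ ^ (α / 2) * cLip L Λ ≤ (cLip L Λ)⁻¹ * cLip L Λ := by gcongr
      _ = 1 := inv_mul_cancel₀ hC.ne'
  have hrα0 : 0 < r ^ α := Real.rpow_pos_of_pos hr0 _
  unfold cLip at hrα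
  -- `cLip` is at least `10 ^ 4 * (L + 1)`. As `r ≤ r ^ α`, this one inequality bounds both `r` and
  -- `L * r ^ α`.
  have hsum : r ^ α + L * r ^ α ≤ 1 / 10 ^ 4 := by
    have : 0 ≤ r ^ α * Λ * (L + 1) := by positivity
    nlinarith
  have hLr : 0 < L * r ^ α := by positivity
  have hrle : r ≤ r ^ α := by
    simpa using Real.rpow_le_rpow_of_exponent_ge hr0 hr1 hα1
  rw [hausdorffSumDist] at hd
  exact {
    patch := h₁
    normal := hΦ
    lipschitz := hlip
    L_pos := hL
    α_pos := hα
    ε_pos := hε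
    ε_lt := hε1
    δ_pos := hδ0
    δ_le_R := by linarith
    holder_le := by
      have h1 : (4 * δ) ^ α ≤ ((ε / L) ^ (1 / α)) ^ α := by
        gcongr
        linarith
      rw [← Real.rpow_mul (by positivity), one_div, inv_mul_cancel₀ hα.ne', Real.rpow_one] at h1
      calc L * (4 * δ) ^ α ≤ L * (ε / L) := by gcongr
        _ = ε := by field_simp
    lip_le := by
      calc Λ * δ ≤ Λ * (ε / (4 * Λ)) := by gcongr
        _ = ε / 4 := by field_simp
    patch' := h₂
    α_le := hα1
    r_pos := hr0
    r_le_R := by nlinarith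
    holder_r_le := by linarith
    r_le := by linarith
    sq_le := by rw [hrr]; linarith
    near := fun a ha => by
      rw [hrr]
      exact exists_norm_sub_le_of_infEDist (le_self_add.trans_lt hd) ha
    near' := fun x hx => by
      rw [hrr]
      exact exists_norm_sub_le_of_infEDist (le_add_self.trans_lt hd) hx }

/-! ### Retraction to the orthogonal projections -/

/-- Near `1` a complete normed algebra has an inverse square root of class `C¹`. -/
theorem exists_inverse_sqrt (𝔸 : Type*) [NormedRing 𝔸] [NormedAlgebra ℝ 𝔸] [CompleteSpace 𝔸] :
    ∃ S : 𝔸 → 𝔸, ContDiffAt ℝ 1 S 1 ∧ S 1 = 1 ∧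
      ∀ᶠ C in 𝓝 (1 : 𝔸), C * (S C * S C) = 1 ∧ S C * S C * C = 1 := by
  -- Completing the square: `1 + 2 q(N) = (1 + N) ^ 2`, so a local inverse of `q` yields square
  -- roots near `1`.
  set q : 𝔸 → 𝔸 := fun N => N + (1 / 2 : ℝ) • (N * N) with hq
  have hqC : ContDiff ℝ 1 q := contDiff_id.add ((contDiff_id.mul contDiff_id).const_smul _)
  have hq' : HasFDerivAt q (ContinuousLinearMap.id ℝ 𝔸) 0 := by
    have h1 := (hasFDerivAt_id (𝕜 := ℝ) (0 : 𝔸)).add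
      (((hasFDerivAt_id (𝕜 := ℝ) (0 : 𝔸)).mul' (hasFDerivAt_id (0 : 𝔸))).const_smul (1 / 2 : ℝ))
    have e : ContinuousLinearMap.id ℝ 𝔸 + (1 / 2 : ℝ) • ((id (0 : 𝔸)) • ContinuousLinearMap.id ℝ 𝔸
        + MulOpposite.op (id (0 : 𝔸)) • ContinuousLinearMap.id ℝ 𝔸)
        = ContinuousLinearMap.id ℝ 𝔸 := by
      ext z
      simp
    rw [e] at h1
    exact h1
  obtain ⟨K, hK, hK0, hKe⟩ := exists_contDiffAt_rightInverse hqC.contDiffAt hq'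
    (by rw [sub_self, norm_zero]; exact one_pos)
  have hq0 : q 0 = 0 := by simp [hq]
  rw [hq0] at hK hK0 hKe
  have hinv : ContDiffAt ℝ 1 (Ring.inverse : 𝔸 → 𝔸) 1 := by
    simpa using contDiffAt_ringInverse ℝ (1 : 𝔸ˣ)
  set e : 𝔸 → 𝔸 := fun C => (1 / 2 : ℝ) • (Ring.inverse C - 1) with he
  have heC : ContDiffAt ℝ 1 e 1 := (hinv.sub contDiffAt_const).const_smul _
  have he1 : e 1 = 0 := by simp [he]
  have het : Filter.Tendsto e (𝓝 1) (𝓝 0) := by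
    have := heC.continuousAt.tendsto
    rwa [he1] at this
  refine ⟨fun C => 1 + K (e C), ?_, by simp [he1, hK0], ?_⟩
  · rw [← he1] at hK
    exact contDiffAt_const.add (hK.comp 1 heC)
  · have hu : ∀ᶠ C in 𝓝 (1 : 𝔸), IsUnit C := Units.nhds (1 : 𝔸ˣ)
    filter_upwards [hu, het.eventually hKe] with C hC hKC
    have hsq : (1 + K (e C)) * (1 + K (e C)) = Ring.inverse C := by
      have h1 : (1 + K (e C)) * (1 + K (e C)) = 1 + (2 : ℝ) • q (K (e C)) := by
        simp only [hq, smul_add, smul_smul]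
        norm_num
        rw [two_smul]
        noncomm_ring
      rw [h1, hKC, he, smul_smul]
      norm_num
    rw [hsq]
    exact ⟨Ring.mul_inverse_cancel _ hC, Ring.inverse_mul_cancel _ hC⟩

/-- The map `W ↦ W * T + T' * W` is within `1 / 2` of `W ↦ 2 W`, hence injective. It yields
commutation and self-adjointness of the square root without functional calculus. -/
theorem eq_zero_of_mul_add_mul_eq_zero {𝔸 : Type*} [NormedRing 𝔸] [NormedAlgebra ℝ 𝔸] {W T T' : 𝔸}
    (h : W * T + T' * W = 0) (hT : ‖T - 1‖ ≤ 1 / 4) (hT' : ‖T' - 1‖ ≤ 1 / 4) : W = 0 := by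
  have h1 : W + W = -(W * (T - 1) + (T' - 1) * W) := by
    have : W + W + (W * (T - 1) + (T' - 1) * W) = W * T + T' * W := by noncomm_ring
    rw [h] at this
    exact eq_neg_of_add_eq_zero_left this
  have h2 : ‖W * (T - 1)‖ ≤ ‖W‖ * (1 / 4) := (norm_mul_le _ _).trans (by gcongr)
  have h3 : ‖(T' - 1) * W‖ ≤ 1 / 4 * ‖W‖ := (norm_mul_le _ _).trans (by gcongr)
  have h4 : ‖W + W‖ ≤ 1 / 2 * ‖W‖ := by
    rw [h1, norm_neg]
    linarith [norm_add_le (W * (T - 1)) ((T' - 1) * W)]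
  rw [← two_smul ℝ W, norm_smul, Real.norm_of_nonneg zero_le_two] at h4
  exact norm_le_zero_iff.1 (by linarith)

/-- Near the idempotents of norm at most `1` there is a `C¹` retraction to the idempotents, which
preserves self-adjointness and is Lipschitz with a uniform constant. -/
theorem exists_idempotent_retraction (𝔸 : Type*) [NormedRing 𝔸] [NormedAlgebra ℝ 𝔸]
    [CompleteSpace 𝔸] [StarRing 𝔸] [NormedStarGroup 𝔸] [StarModule ℝ 𝔸] (hone : ‖(1 : 𝔸)‖ ≤ 1) :
    ∃ (η : ℝ) (K : ℝ≥0) (F : 𝔸 → 𝔸), 0 < η ∧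
      (∀ P : 𝔸, P * P = P → F P = P) ∧
      (∀ P A : 𝔸, P * P = P → ‖P‖ ≤ 1 → ‖A - P‖ ≤ η →
        ContDiffAt ℝ 1 F A ∧ F A * F A = F A ∧ (star A = A → star (F A) = F A)) ∧
      ∀ P P' A A' : 𝔸, P * P = P → ‖P‖ ≤ 1 → P' * P' = P' → ‖P'‖ ≤ 1 → ‖A - P‖ ≤ η →
        ‖A' - P'‖ ≤ η → ‖F A - F A'‖ ≤ K * ‖A - A'‖ := by
  obtain ⟨S, hS, hS1, hSe⟩ := exists_inverse_sqrt 𝔸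
  obtain ⟨KS, t, ht, hlip⟩ := hS.exists_lipschitzOnWith
  have hclose : ∀ᶠ C in 𝓝 (1 : 𝔸), ‖S C - 1‖ ≤ 1 / 4 := by
    have hc : ContinuousAt (fun C => ‖S C - 1‖) 1 := (hS.continuousAt.sub continuousAt_const).norm
    exact (hc.eventually_lt continuousAt_const (by simp [hS1])).mono fun _ h => h.le
  obtain ⟨η₀, hη₀, hball⟩ := Metric.eventually_nhds_iff.1
    ((hS.eventually (by simp)).and (hSe.and (hclose.and ht)))
  set η := min (1 / 2) (η₀ / 32) with hη
  have hη0 : 0 < η := by positivity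
  have hη1 : η ≤ 1 / 2 := min_le_left _ _
  have hη2 : η ≤ η₀ / 32 := min_le_right _ _
  set B : 𝔸 → 𝔸 := fun A => A + A - 1 with hB
  set F : 𝔸 → 𝔸 :=
    fun A => (1 / 2 : ℝ) • (1 + B A * S (B A * B A)) with hF
  -- Idempotents correspond to involutions `2 P - 1`, and `F` replaces `B A` by its sign `B A * (B A
  -- ^ 2)^(-1/2)`. All involutions have the same square `1`, so one ball around `1` serves every
  -- `P`, and `η` and `K` are uniform.
  have hBP : ∀ P : 𝔸, P * P = P → B P * B P = 1 := by
    intro P hP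
    have : B P * B P = (P * P - P) + (P * P - P) + (P * P - P) + (P * P - P) + 1 := by
      simp only [hB]
      noncomm_ring
    rw [this, hP]
    simp
  have hest : ∀ P A : 𝔸, P * P = P → ‖P‖ ≤ 1 → ‖A - P‖ ≤ η →
      ‖B A‖ ≤ 4 ∧ dist (B A * B A) 1 < η₀ := by
    intro P A hPP hP hA
    have hBPn : ‖B P‖ ≤ 3 := by
      have h1 := norm_sub_le (P + P) 1
      have h2 := norm_add_le P P
      change ‖P + P - 1‖ ≤ 3
      linarith
    set X := B A - B P with hX
    have hXe : X = (A - P) + (A - P) := by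
      simp only [hX, hB]; abel
    have hXn : ‖X‖ ≤ 2 * η := by
      rw [hXe]
      linarith [norm_add_le (A - P) (A - P)]
    have hBA : B A = B P + X := by rw [hX]; abel
    refine ⟨?_, ?_⟩
    · rw [hBA]
      linarith [norm_add_le (B P) X]
    · rw [dist_eq_norm, ← hBP P hPP, hBA]
      have e : (B P + X) * (B P + X)
          - B P * B P
          = (B P * X + X * B P) + X * X := by noncomm_ring
      rw [e]
      have h1 : ‖B P * X‖ ≤ 3 * (2 * η) := (norm_mul_le _ _).trans (by gcongr)
      have h2 : ‖X * B P‖ ≤ (2 * η) * 3 := (norm_mul_le _ _).trans (by gcongr)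
      have h3 : ‖X * X‖ ≤ (2 * η) * (2 * η) := (norm_mul_le _ _).trans (by gcongr)
      have h4 := norm_add_le (B P * X + X * B P) (X * X)
      have h5 := norm_add_le (B P * X) (X * B P)
      nlinarith
  refine ⟨η, 32 * KS + 2, F, hη0, fun P hP => ?_, fun P A hP hPn hA => ?_,
    fun P P' A A' hP hPn hP' hPn' hA hA' => ?_⟩
  · simp only [hF]
    rw [hBP P hP, hS1, mul_one]
    simp only [hB, add_sub_cancel]
    rw [← two_smul ℝ P, smul_smul]
    norm_num
  · obtain ⟨hBn, hd⟩ := hest P A hP hPn hA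
    obtain ⟨hSC, ⟨hC1, hC2⟩, hT, -⟩ := hball hd
    set T := S (B A * B A) with hTdef
    have hcomm : B A * T = T * B A := by
      have h1 : B A * (T * T) = T * T * B A := by
        calc B A * (T * T) = (T * T * (B A * B A)) * (B A * (T * T)) := by rw [hC2, one_mul]
          _ = T * T * B A * ((B A * B A) * (T * T)) := by noncomm_ring
          _ = T * T * B A := by rw [hC1, mul_one]
      have h2 : (B A * T - T * B A) * T + T * (B A * T - T * B A) = 0 := by
        have : (B A * T - T * B A) * T + T * (B A * T - T * B A) = B A * (T * T) - T * T * B A := by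
          noncomm_ring
        rw [this, h1, sub_self]
      exact sub_eq_zero.1 (eq_zero_of_mul_add_mul_eq_zero h2 hT hT)
    have hU : (B A * T) * (B A * T) = 1 := by
      calc (B A * T) * (B A * T) = B A * (T * B A) * T := by noncomm_ring
        _ = B A * (B A * T) * T := by rw [hcomm]
        _ = B A * B A * (T * T) := by noncomm_ring
        _ = 1 := hC1
    refine ⟨?_, ?_, fun hA' => ?_⟩
    · have hBC : ContDiffAt ℝ 1 B A := (contDiffAt_id.add contDiffAt_id).sub contDiffAt_const
      have h1 : ContDiffAt ℝ 1 (fun A => S (B A * B A)) A := hSC.comp A (hBC.mul hBC)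
      exact (contDiffAt_const.add (hBC.mul h1)).const_smul _
    · change ((1 / 2 : ℝ) • (1 + B A * T)) * ((1 / 2 : ℝ) • (1 + B A * T))
        = (1 / 2 : ℝ) • (1 + B A * T)
      have h1 : (1 + B A * T) * (1 + B A * T) = (2 : ℝ) • (1 + B A * T) := by
        have : (1 + B A * T) * (1 + B A * T) = 1 + B A * T + B A * T + (B A * T) * (B A * T) := by
          noncomm_ring
        rw [this, hU, two_smul]
        abel
      rw [smul_mul_smul_comm, h1, smul_smul]
      norm_num
    · have hBs : star (B A) = B A := by
        simp only [hB, star_sub, star_add, hA', star_one]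
      -- `T` and `star T` are two square roots of the same element, both near `1`, and such roots
      -- are unique.
      have hTs : star T = T := by
        have h1 : B A * B A * (star T * star T) = 1 := by
          have := congrArg star hC2
          simpa only [star_mul, hBs, star_one] using this
        have h2 : T * T = star T * star T := by
          calc T * T = T * T * (B A * B A * (star T * star T)) := by rw [h1, mul_one]
            _ = (T * T * (B A * B A)) * (star T * star T) := by noncomm_ring
            _ = star T * star T := by rw [hC2, one_mul]
        have h3 : (T - star T) * T + star T * (T - star T) = 0 := by
          have : (T - star T) * T + star T * (T - star T) = T * T - star T * star T := by
            noncomm_ring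
          rw [this, h2, sub_self]
        have h4 : ‖star T - 1‖ ≤ 1 / 4 := by
          rw [← norm_star, star_sub, star_star, star_one]; exact hT
        exact (sub_eq_zero.1 (eq_zero_of_mul_add_mul_eq_zero h3 hT h4)).symm
      change star ((1 / 2 : ℝ) • (1 + B A * T)) = (1 / 2 : ℝ) • (1 + B A * T)
      rw [star_smul, star_trivial, star_add, star_one, star_mul, hTs, hBs, hcomm]
  · obtain ⟨hBn, hd⟩ := hest P A hP hPn hA
    obtain ⟨hBn', hd'⟩ := hest P' A' hP' hPn' hA'
    obtain ⟨-, -, hT, htm⟩ := hball hd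
    obtain ⟨-, -, hT', htm'⟩ := hball hd'
    have hBB : ‖B A - B A'‖ ≤ 2 * ‖A - A'‖ := by
      have : B A - B A' = (A - A') + (A - A') := by simp only [hB]; abel
      rw [this]
      linarith [norm_add_le (A - A') (A - A')]
    have hCC : ‖B A * B A - B A' * B A'‖ ≤ 16 * ‖A - A'‖ := by
      have e : B A * B A - B A' * B A' = B A * (B A - B A') + (B A - B A') * B A' := by
        noncomm_ring
      rw [e]
      have h1 : ‖B A * (B A - B A')‖ ≤ 4 * (2 * ‖A - A'‖) := (norm_mul_le _ _).trans (by gcongr)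
      have h2 : ‖(B A - B A') * B A'‖ ≤ (2 * ‖A - A'‖) * 4 := (norm_mul_le _ _).trans (by gcongr)
      linarith [norm_add_le (B A * (B A - B A')) ((B A - B A') * B A')]
    have hl := hlip.dist_le_mul _ htm _ htm'
    rw [dist_eq_norm, dist_eq_norm] at hl
    set T := S (B A * B A) with hTdef
    set T' := S (B A' * B A') with hTdef'
    have hTn : ‖T'‖ ≤ 2 := by
      have := norm_add_le (T' - 1) 1
      rw [sub_add_cancel] at this
      linarith
    have hTT : ‖T - T'‖ ≤ KS * (16 * ‖A - A'‖) := hl.trans (by gcongr)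
    have e : F A - F A' = (1 / 2 : ℝ) • (B A * (T - T') + (B A - B A') * T') := by
      have h1 : B A * (T - T') + (B A - B A') * T' = (1 + B A * T) - (1 + B A' * T') := by
        noncomm_ring
      rw [h1, smul_sub]
    rw [e, norm_smul, Real.norm_of_nonneg (by norm_num)]
    have h1 : ‖B A * (T - T')‖ ≤ 4 * (KS * (16 * ‖A - A'‖)) := (norm_mul_le _ _).trans (by gcongr)
    have h2 : ‖(B A - B A') * T'‖ ≤ (2 * ‖A - A'‖) * 2 := (norm_mul_le _ _).trans (by gcongr)
    have h3 := norm_add_le (B A * (T - T')) ((B A - B A') * T')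
    push_cast
    nlinarith [norm_nonneg (A - A')]

/-- `P` is injective on the range of `Q`: a vector there killed by `P` satisfies `v = (Q - P) v`. -/
theorem finrank_range_le_of_norm_sub_lt_one {n : ℕ} {P Q : Euc n →L[ℝ] Euc n}
    (hQ : Q * Q = Q) (h : ‖Q - P‖ < 1) :
    Module.finrank ℝ (LinearMap.range (Q : Euc n →ₗ[ℝ] Euc n))
      ≤ Module.finrank ℝ (LinearMap.range (P : Euc n →ₗ[ℝ] Euc n)) := by
  let f : LinearMap.range (Q : Euc n →ₗ[ℝ] Euc n) →ₗ[ℝ] LinearMap.range (P : Euc n →ₗ[ℝ] Euc n) :=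
    (P : Euc n →ₗ[ℝ] Euc n).rangeRestrict.domRestrict _
  refine LinearMap.finrank_le_finrank_of_injective (f := f) ?_
  rw [injective_iff_map_eq_zero]
  rintro ⟨v, w, rfl⟩ hv
  have hv' : P (Q w) = 0 := congrArg Subtype.val hv
  have hQQ : Q (Q w) = Q w := DFunLike.congr_fun hQ w
  have h1 := (Q - P).le_opNorm (Q w)
  rw [sub_apply, hQQ, hv', sub_zero] at h1
  have h2 : Q w = 0 := by
    by_contra hne
    have : 0 < ‖Q w‖ := norm_pos_iff.2 hne
    nlinarith
  exact Subtype.ext h2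

/-- An idempotent at distance less than `1` from an orthogonal projection has the same trace. -/
theorem trace_eq_of_norm_sub_lt_one {n : ℕ} {V : Submodule ℝ (Euc n)} {Q : Euc n →L[ℝ] Euc n}
    (hQ : Q * Q = Q) (h : ‖Q - V.starProjection‖ < 1) :
    LinearMap.trace ℝ (Euc n) (Q : Euc n →ₗ[ℝ] Euc n) = Module.finrank ℝ V := by
  have hQl : IsIdempotentElem (Q : Euc n →ₗ[ℝ] Euc n) :=
    LinearMap.ext fun v => DFunLike.congr_fun hQ v
  have h1 := finrank_range_le_of_norm_sub_lt_one hQ h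
  have h2 := finrank_range_le_of_norm_sub_lt_one (P := Q) V.isIdempotentElem_starProjection
    (by rwa [norm_sub_rev])
  rw [(LinearMap.IsIdempotentElem.isProj_range _ hQl).trace, le_antisymm h1 h2]
  have h3 : LinearMap.range (V.starProjection : Euc n →ₗ[ℝ] Euc n) = V :=
    V.range_starProjection
  rw [h3]

/-! ### Nets, Hölder normal planes and uniform normal maps -/

/-- Separated finite subsets of a compact set have bounded cardinality. -/
theorem IsCompact.exists_card_le_of_separated {X : Type*} [PseudoMetricSpace X] {K : Set X}
    (hK : IsCompact K) {r : ℝ} (hr : 0 < r) :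
    ∃ M : ℕ, ∀ I : Finset X, (I : Set X) ⊆ K →
      (∀ i ∈ I, ∀ j ∈ I, i ≠ j → r ≤ dist i j) → I.card ≤ M := by
  obtain ⟨t, -, htf, ht⟩ := hK.finite_cover_balls (half_pos hr)
  refine ⟨htf.toFinset.card, fun I hI hsep => ?_⟩
  have hex : ∀ i ∈ I, ∃ c ∈ t, i ∈ ball c (r / 2) := fun i hi => by
    simpa using ht (hI hi)
  choose! c hct hci using hex
  refine Finset.card_le_card_of_injOn c (fun i hi => by simpa using hct i hi) ?_
  intro i hi j hj hij
  by_contra hne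
  have h1 := hci i hi
  have h2 := hci j hj
  rw [← hij] at h2
  rw [mem_ball] at h1 h2
  linarith [hsep i hi j hj hne, dist_triangle_right i j (c i)]

/-- A compact set contains a finite separated net. -/
theorem IsCompact.exists_separated_net {X : Type*} [PseudoMetricSpace X] {K : Set X}
    (hK : IsCompact K) {r : ℝ} (hr : 0 < r) :
    ∃ I : Finset X, (I : Set X) ⊆ K ∧ (∀ i ∈ I, ∀ j ∈ I, i ≠ j → r ≤ dist i j) ∧
      ∀ x ∈ K, ∃ i ∈ I, dist x i ≤ r := by
  classical
  obtain ⟨M, hM⟩ := hK.exists_card_le_of_separated hr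
  -- A separated set of largest cardinality is a net, since a point far from it could be added.
  set A : Set ℕ := {k | ∃ I : Finset X, (I : Set X) ⊆ K ∧
    (∀ i ∈ I, ∀ j ∈ I, i ≠ j → r ≤ dist i j) ∧ I.card = k} with hA
  have hbdd : BddAbove A := ⟨M, by rintro k ⟨I, h1, h2, rfl⟩; exact hM I h1 h2⟩
  obtain ⟨I, hIK, hsep, hcard⟩ := Nat.sSup_mem (s := A) ⟨0, ∅, by simp, by simp, by simp⟩ hbdd
  refine ⟨I, hIK, hsep, fun x hx => ?_⟩
  by_contra! hcon
  have hxI : x ∉ I := fun hxI => by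
    have := hcon x hxI
    rw [dist_self] at this
    linarith
  have hmem : (insert x I).card ∈ A := by
    refine ⟨insert x I, ?_, ?_, rfl⟩
    · rw [Finset.coe_insert]
      exact insert_subset hx hIK
    · intro i hi j hj hij
      rw [Finset.mem_insert] at hi hj
      rcases hi with rfl | hi <;> rcases hj with rfl | hj
      · exact absurd rfl hij
      · exact (hcon j hj).le
      · rw [dist_comm]; exact (hcon i hi).le
      · exact hsep i hi j hj hij
  have := le_csSup hbdd hmem
  rw [Finset.card_insert_of_notMem hxI, ← hcard] at this
  omega

/-- A velocity of a curve in `S` at `b` is fixed by the derivative of a map that is the identity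
on `S` near `b`. -/
theorem fderiv_apply_eq_of_mem_tangentPlane {n : ℕ} {S : Set (Euc n)} {b z : Euc n}
    {X : Euc n → Euc n} {X' : Euc n →L[ℝ] Euc n} (hX' : HasFDerivAt X X' b)
    (hX : ∀ᶠ y in 𝓝 b, y ∈ S → X y = y) (hz : z ∈ tangentPlane S b) : X' z = z := by
  have hsub : tangentPlane S b ≤ LinearMap.eqLocus (X' : Euc n →ₗ[ℝ] Euc n) LinearMap.id := by
    refine Submodule.span_le.2 ?_
    rintro v ⟨γ, rfl, hγS, hγ⟩
    have h1 : HasDerivAt (fun t => X (γ t)) (X' v) 0 := hX'.comp_hasDerivAt 0 hγ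
    have h2 : (fun t => X (γ t)) =ᶠ[𝓝 0] γ := by
      filter_upwards [hγS, hγ.continuousAt.eventually hX] with t ht ht2
      exact ht2 ht
    exact (h1.congr_of_eventuallyEq h2.symm).unique hγ
  exact hsub hz

namespace GraphPatchClass

variable {m n : ℕ} {α R L d : ℝ} {S : Set (Euc n)}

/-- The translated chart `y ↦ X (y - a)` is the identity on `S` near `b`, so its derivative at `b`
fixes the tangent plane there, while that derivative is Hölder close to the projection at `a`. -/
theorem norm_tangentPlane_sub_le (hS : GraphPatchClass m n α R L d S) (hL : 0 < L) (hα : 0 < α)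
    {a b z : Euc n} (ha : a ∈ S) (hab : ‖b - a‖ < R) (hz : z ∈ tangentPlane S b) :
    ‖z - (tangentPlane S a).starProjection z‖ ≤ L * ‖b - a‖ ^ α * ‖z‖ := by
  obtain ⟨X, hX, -, -, -, hXb, -, hX'⟩ := hS.exists_chart hL hα ha
  have hd : HasFDerivAt (fun y => X (y - a)) (fderiv ℝ X (b - a)) b := by
    have h1 : HasFDerivAt X (fderiv ℝ X (b - a)) (b - a) :=
      (hX.differentiable one_ne_zero _).hasFDerivAt
    exact HasFDerivAt.comp (f := fun y => y - a) b h1 ((hasFDerivAt_id b).sub_const a)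
  have hfix := fderiv_apply_eq_of_mem_tangentPlane (S := S) hd (by
    have hc : ContinuousAt (fun y : Euc n => ‖y - a‖) b := by fun_prop
    filter_upwards [hc.eventually_lt continuousAt_const hab] with y hy hyS
    exact hXb y hyS hy) hz
  have := ContinuousLinearMap.le_of_opNorm_le _ (hX' (b - a)) z
  rwa [sub_apply, hfix] at this

/-- The normal projections depend Hölder continuously on the point. -/
theorem norm_starProjection_orthogonal_sub_le (hS : GraphPatchClass m n α R L d S) (hL : 0 < L)
    (hα : 0 < α) {a b : Euc n} (ha : a ∈ S) (hb : b ∈ S) (hab : ‖b - a‖ < R) :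
    ‖(tangentPlane S b)ᗮ.starProjection - (tangentPlane S a)ᗮ.starProjection‖
      ≤ 2 * (L * ‖b - a‖ ^ α) := by
  set θ := L * ‖b - a‖ ^ α with hθ
  have hθ0 : 0 ≤ θ := by positivity
  set V := tangentPlane S a with hV
  set W := tangentPlane S b with hW
  have h1 : ∀ z ∈ W, ‖z - V.starProjection z‖ ≤ θ * ‖z‖ := fun z hz =>
    hS.norm_tangentPlane_sub_le hL hα ha hab hz
  have h2 : ∀ z ∈ V, ‖z - W.starProjection z‖ ≤ θ * ‖z‖ := fun z hz => by
    have := hS.norm_tangentPlane_sub_le hL hα hb (by rwa [norm_sub_rev]) hz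
    rwa [norm_sub_rev a b] at this
  refine ContinuousLinearMap.opNorm_le_bound _ (by positivity) fun z => ?_
  rw [sub_apply, Submodule.starProjection_orthogonal_val, Submodule.starProjection_orthogonal_val]
  -- The identity `(1 - W) - (1 - V) = V (1 - W) - (1 - V) W` reduces the difference to the two
  -- one-sided bounds.
  have e : z - W.starProjection z - (z - V.starProjection z)
      = V.starProjection (z - W.starProjection z)
        - (W.starProjection z - V.starProjection (W.starProjection z)) := by
    rw [map_sub]; abel
  rw [e]
  have h3 := Submodule.norm_starProjection_sub_le hθ0 h2 z
  have h4 := h1 _ (W.starProjection_apply_mem z)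
  have h5 : θ * ‖W.starProjection z‖ ≤ θ * ‖z‖ := by
    gcongr
    exact Submodule.norm_starProjection_apply_le _ _
  linarith [norm_sub_le (V.starProjection (z - W.starProjection z))
    (W.starProjection z - V.starProjection (W.starProjection z))]

/-- The span of velocities carries no dimension by definition. It is identified with the range of
the injective derivative of a graph patch over an `m`-plane. -/
theorem finrank_tangentPlane (hS : GraphPatchClass m n α R L d S) {x : Euc n} (hx : x ∈ S) :
    Module.finrank ℝ (tangentPlane S x) = m := by
  obtain ⟨V, hV, f, hf, -, r, hr, hgraph⟩ := hS.submanifold.2 x hx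
  let pr : Euc n →L[ℝ] V := V.orthogonalProjectionOnto
  have hpr : ∀ (ξ : V) (ν : Vᗮ), pr ((ξ : Euc n) + (ν : Euc n)) = ξ := fun ξ ν => by
    rw [map_add]
    simp [pr]
  have hf0 : f 0 = 0 := by
    have hmem : x ∈ graphOver x V f ∩ ball x r := by
      rw [← hgraph]; exact ⟨hx, mem_ball_self hr⟩
    obtain ⟨ξ, hξ⟩ := hmem.1
    have h0 : (ξ : Euc n) + (f ξ : Euc n) = 0 := by
      rw [add_assoc] at hξ
      exact left_eq_add.1 hξ
    have hξ0 : ξ = 0 := by rw [← hpr ξ (f ξ), h0, map_zero]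
    subst hξ0
    simpa using h0
  have hdf : HasFDerivAt f (fderiv ℝ f 0) 0 := (hf.differentiable one_ne_zero 0).hasFDerivAt
  let J : V →L[ℝ] Euc n := V.subtypeL + Vᗮ.subtypeL ∘L fderiv ℝ f 0
  have hJ : HasFDerivAt (fun ξ : V => x + ((ξ : Euc n) + (f ξ : Euc n))) J 0 :=
    ((V.subtypeL.hasFDerivAt).add ((Vᗮ.subtypeL).hasFDerivAt.comp 0 hdf)).const_add x
  have hJinj : Function.Injective J := fun ξ η hξη => by
    have h1 : pr (J ξ) = pr (J η) := congrArg pr hξη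
    have h2 : ∀ ξ, J ξ = (ξ : Euc n) + ((fderiv ℝ f 0 ξ : Vᗮ) : Euc n) := fun ξ => rfl
    rwa [h2, h2, hpr, hpr] at h1
  have hrange : tangentPlane S x = LinearMap.range (J : V →ₗ[ℝ] Euc n) := by
    apply le_antisymm
    · intro z hz
      have hd : HasFDerivAt (fun y => x + ((pr (y - x) : Euc n) + (f (pr (y - x)) : Euc n)))
          (J ∘L pr) x := by
        have h1 : HasFDerivAt (fun y => pr (y - x)) pr x :=
          HasFDerivAt.comp (f := fun y => y - x) x pr.hasFDerivAt ((hasFDerivAt_id x).sub_const x)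
        have h2 : HasFDerivAt (fun ξ : V => x + ((ξ : Euc n) + (f ξ : Euc n))) J (pr (x - x)) := by
          rwa [sub_self, map_zero]
        exact HasFDerivAt.comp (f := fun y => pr (y - x)) x h2 h1
      have hfix := fderiv_apply_eq_of_mem_tangentPlane (S := S) hd (by
        filter_upwards [ball_mem_nhds x hr] with y hy hyS
        have hmem : y ∈ graphOver x V f ∩ ball x r := by rw [← hgraph]; exact ⟨hyS, hy⟩
        obtain ⟨ξ, hξ⟩ := hmem.1
        have h0 : y - x = (ξ : Euc n) + (f ξ : Euc n) := by rw [hξ]; abel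
        rw [h0, hpr, hξ, add_assoc]) hz
      exact ⟨pr z, hfix⟩
    · rintro _ ⟨ξ, rfl⟩
      refine Submodule.subset_span ⟨fun t => x + (((t • ξ : V) : Euc n) + (f (t • ξ) : Euc n)),
        by simp [hf0], ?_, ?_⟩
      · have hc : ContinuousAt
            (fun t : ℝ => x + (((t • ξ : V) : Euc n) + (f (t • ξ) : Euc n))) 0 := by
          have := hf.continuous
          fun_prop
        have h0 : x + ((((0 : ℝ) • ξ : V) : Euc n) + (f ((0 : ℝ) • ξ) : Euc n)) = x := by
          simp [hf0]
        have hb : ∀ᶠ t in 𝓝 (0 : ℝ),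
            x + (((t • ξ : V) : Euc n) + (f (t • ξ) : Euc n)) ∈ ball x r :=
          hc (by beta_reduce; rw [h0]; exact ball_mem_nhds x hr)
        filter_upwards [hb] with t ht
        have hmem : x + (((t • ξ : V) : Euc n) + (f (t • ξ) : Euc n)) ∈ graphOver x V f ∩ ball x r :=
          ⟨⟨t • ξ, by rw [add_assoc]⟩, ht⟩
        rw [← hgraph] at hmem
        exact hmem.1
      · have h1 : HasDerivAt (fun t : ℝ => t • ξ) ξ 0 := by
          simpa using (hasDerivAt_id (0 : ℝ)).smul_const ξ
        have h2 : HasFDerivAt (fun ξ : V => x + ((ξ : Euc n) + (f ξ : Euc n))) J ((0 : ℝ) • ξ) := by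
          rwa [zero_smul]
        exact h2.comp_hasDerivAt 0 h1
  rw [hrange, ← hV]
  exact LinearMap.finrank_range_of_inj hJinj

end GraphPatchClass

/-- A sum of translates of a bump function over a separated set is Lipschitz, with a constant that
depends only on the number of translates that overlap. -/
theorem norm_sum_bump_smul_sub_le {E F : Type*} [NormedAddCommGroup E] [NormedAddCommGroup F]
    [NormedSpace ℝ F] {φ : E → ℝ} {C : ℝ≥0} {r : ℝ} {M : ℕ} {I : Finset E} {P : E → F}
    (hφ : LipschitzWith C φ) (hφ0 : ∀ y, r ≤ ‖y‖ → φ y = 0)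
    (hM : ∀ x, (I.filter fun i => ‖x - i‖ < r).card ≤ M) (hP : ∀ i ∈ I, ‖P i‖ ≤ 1) (x y : E) :
    ‖∑ i ∈ I, φ (x - i) • P i - ∑ i ∈ I, φ (y - i) • P i‖ ≤ 2 * M * C * ‖x - y‖ := by
  classical
  set J := (I.filter fun i => ‖x - i‖ < r) ∪ (I.filter fun i => ‖y - i‖ < r) with hJ
  have hJI : J ⊆ I := Finset.union_subset (Finset.filter_subset _ _) (Finset.filter_subset _ _)
  have hcard : (J.card : ℝ) ≤ 2 * M := by
    have h1 : J.card ≤ M + M := (Finset.card_union_le _ _).trans (add_le_add (hM x) (hM y))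
    rw [two_mul]
    exact_mod_cast h1
  rw [← Finset.sum_sub_distrib, ← Finset.sum_subset hJI]
  · have hterm : ∀ i ∈ J, ‖φ (x - i) • P i - φ (y - i) • P i‖ ≤ C * ‖x - y‖ := by
      intro i hi
      rw [← sub_smul, norm_smul]
      have h1 := hφ.dist_le_mul (x - i) (y - i)
      rw [dist_eq_norm, dist_eq_norm, sub_sub_sub_cancel_right] at h1
      calc ‖φ (x - i) - φ (y - i)‖ * ‖P i‖ ≤ (C * ‖x - y‖) * 1 := by
            gcongr
            exact hP i (hJI hi)
        _ = _ := mul_one _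
    calc _ ≤ ∑ i ∈ J, ‖φ (x - i) • P i - φ (y - i) • P i‖ := norm_sum_le _ _
      _ ≤ J.card • (C * ‖x - y‖) := Finset.sum_le_card_nsmul _ _ _ hterm
      _ = J.card * (C * ‖x - y‖) := nsmul_eq_mul _ _
      _ ≤ (2 * M) * (C * ‖x - y‖) := by gcongr
      _ = _ := by ring
  · intro i hi hiJ
    rw [hJ, Finset.mem_union, Finset.mem_filter, Finset.mem_filter, not_or] at hiJ
    have h1 : r ≤ ‖x - i‖ := not_lt.1 fun h => hiJ.1 ⟨hi, h⟩
    have h2 : r ≤ ‖y - i‖ := not_lt.1 fun h => hiJ.2 ⟨hi, h⟩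
    rw [hφ0 _ h1, hφ0 _ h2, sub_self]

/-- A weighted mean is Lipschitz if the sums that define it are. -/
theorem norm_inv_smul_sub_le {F : Type*} [NormedAddCommGroup F] [NormedSpace ℝ F] {a b c : ℝ}
    {u v : F} (ha : 1 ≤ a) (hb : 1 ≤ b) (hab : |a - b| ≤ c) (huv : ‖u - v‖ ≤ c) (hv : ‖v‖ ≤ b) :
    ‖a⁻¹ • u - b⁻¹ • v‖ ≤ 2 * c := by
  have ha0 : 0 < a := by linarith
  have hb0 : 0 < b := by linarith
  have hc : 0 ≤ c := (abs_nonneg _).trans hab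
  have hai : a⁻¹ ≤ 1 := inv_le_one_of_one_le₀ ha
  have e : a⁻¹ • u - b⁻¹ • v = a⁻¹ • (u - v) - (a⁻¹ * (a - b) * b⁻¹) • v := by
    have h1 : a⁻¹ * (a - b) * b⁻¹ = b⁻¹ - a⁻¹ := by field_simp
    rw [h1, smul_sub, sub_smul]
    abel
  rw [e]
  have h1 : ‖a⁻¹ • (u - v)‖ ≤ c := by
    rw [norm_smul, Real.norm_of_nonneg (by positivity)]
    calc a⁻¹ * ‖u - v‖ ≤ 1 * c := by gcongr
      _ = c := one_mul c
  have h2 : ‖(a⁻¹ * (a - b) * b⁻¹) • v‖ ≤ c := by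
    rw [norm_smul, Real.norm_eq_abs, abs_mul, abs_mul, abs_of_pos (inv_pos.2 ha0),
      abs_of_pos (inv_pos.2 hb0)]
    calc a⁻¹ * |a - b| * b⁻¹ * ‖v‖ ≤ 1 * c * b⁻¹ * b := by gcongr
      _ = c := by field_simp
  linarith [norm_sub_le (a⁻¹ • (u - v)) ((a⁻¹ * (a - b) * b⁻¹) • v)]

/-- The normal projections of the submanifolds of the class have uniformly Lipschitz mean values
of class `C¹` that approximate them uniformly. -/
theorem exists_uniform_mean (m n : ℕ) {R L α : ℝ} (hR : 0 < R) (hL : 0 < L) (hα : 0 < α) {η : ℝ}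
    (hη : 0 < η) :
    ∃ Λ : ℝ≥0, ∀ (d : ℝ) (S : Set (Euc n)), GraphPatchClass m n α R L d S →
      ∃ A : Euc n → Euc n →L[ℝ] Euc n, ContDiffOn ℝ 1 A S ∧ LipschitzOnWith Λ A S ∧
        ∀ x ∈ S, star (A x) = A x ∧ ‖A x - (tangentPlane S x)ᗮ.starProjection‖ ≤ η := by
  classical
  set r := min (R / 4) ((η / (2 * L)) ^ (1 / α) / 2) with hr
  have hpow : 0 < (η / (2 * L)) ^ (1 / α) := Real.rpow_pos_of_pos (by positivity) _
  have hr0 : 0 < r := lt_min (by positivity) (by positivity)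
  have hrR : 2 * r < R := by linarith [min_le_left (R / 4) ((η / (2 * L)) ^ (1 / α) / 2)]
  have hrη : 2 * (L * (2 * r) ^ α) ≤ η := by
    have h1 : 2 * r ≤ (η / (2 * L)) ^ (1 / α) := by
      linarith [min_le_right (R / 4) ((η / (2 * L)) ^ (1 / α) / 2)]
    have h2 : (2 * r) ^ α ≤ ((η / (2 * L)) ^ (1 / α)) ^ α := by gcongr
    rw [← Real.rpow_mul (by positivity), one_div, inv_mul_cancel₀ hα.ne', Real.rpow_one] at h2
    calc 2 * (L * (2 * r) ^ α) ≤ 2 * (L * (η / (2 * L))) := by gcongr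
      _ = η := by field_simp
  let φ : ContDiffBump (0 : Euc n) := ⟨r, 2 * r, hr0, by linarith⟩
  obtain ⟨C, hC⟩ := ContDiff.lipschitzWith_of_hasCompactSupport (𝕂 := ℝ) φ.hasCompactSupport
    (φ.contDiff (n := 1)) one_ne_zero
  obtain ⟨M, hM⟩ := (isCompact_closedBall (0 : Euc n) (2 * r)).exists_card_le_of_separated hr0
  -- The radius, the bump constant `C` and the packing number `M` of the ball of radius `2 * r` are
  -- fixed before `S` and `d`. The outer factor `2` comes from normalizing the weights.
  refine ⟨2 * (2 * M * C), fun d S hS => ?_⟩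
  obtain ⟨I, hIS, hsep, hnet⟩ := hS.submanifold.1.exists_separated_net hr0
  set P : Euc n → Euc n →L[ℝ] Euc n := fun x => (tangentPlane S x)ᗮ.starProjection with hP
  have hPn : ∀ x, ‖P x‖ ≤ 1 := fun x => Submodule.starProjection_norm_le _
  have hφ0 : ∀ y, 2 * r ≤ ‖y‖ → φ y = 0 := fun y hy =>
    φ.zero_of_le_dist (by rwa [dist_zero_right])
  have hMI : ∀ x, (I.filter fun i => ‖x - i‖ < 2 * r).card ≤ M := by
    intro x
    set J := I.filter fun i => ‖x - i‖ < 2 * r with hJ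
    have hinj : Function.Injective fun i : Euc n => i - x := sub_left_injective
    rw [← Finset.card_image_of_injective J hinj]
    refine hM _ ?_ ?_
    · intro y hy
      rw [Finset.coe_image] at hy
      obtain ⟨i, hi, rfl⟩ := hy
      have := (Finset.mem_filter.1 hi).2
      rw [mem_closedBall_zero_iff, norm_sub_rev]
      exact this.le
    · intro y hy z hz hyz
      obtain ⟨i, hi, rfl⟩ := Finset.mem_image.1 hy
      obtain ⟨j, hj, rfl⟩ := Finset.mem_image.1 hz
      rw [dist_sub_right]
      exact hsep i (Finset.mem_filter.1 hi).1 j (Finset.mem_filter.1 hj).1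
        fun hij => hyz (by rw [hij])
  set N : Euc n → ℝ := fun x => ∑ i ∈ I, φ (x - i) with hN
  set B : Euc n → Euc n →L[ℝ] Euc n := fun x => ∑ i ∈ I, φ (x - i) • P i with hB
  have hN1 : ∀ x ∈ S, 1 ≤ N x := by
    intro x hx
    obtain ⟨i, hi, hxi⟩ := hnet x hx
    have h1 : φ (x - i) = 1 := φ.one_of_mem_closedBall (by
      rw [mem_closedBall_zero_iff, ← dist_eq_norm]; exact hxi)
    rw [← h1]
    exact Finset.single_le_sum (f := fun i => φ (x - i)) (fun _ _ => φ.nonneg) hi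
  have hBN : ∀ x, ‖B x‖ ≤ N x := by
    intro x
    refine (norm_sum_le _ _).trans (Finset.sum_le_sum fun i _ => ?_)
    rw [norm_smul, Real.norm_of_nonneg φ.nonneg]
    exact mul_le_of_le_one_right φ.nonneg (hPn i)
  have hφi : ∀ i : Euc n, ContDiff ℝ 1 fun x => φ (x - i) := fun i =>
    φ.contDiff.comp (contDiff_id.sub contDiff_const)
  have hNC : ContDiff ℝ 1 N := ContDiff.sum fun i _ => hφi i
  have hBC : ContDiff ℝ 1 B := ContDiff.sum fun i _ => (hφi i).smul contDiff_const
  refine ⟨fun x => (N x)⁻¹ • B x, fun x hx => ?_, ?_, fun x hx => ⟨?_, ?_⟩⟩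
  · exact ((hNC.contDiffAt.inv (by linarith [hN1 x hx])).smul hBC.contDiffAt).contDiffWithinAt
  · refine LipschitzOnWith.of_dist_le_mul fun x hx y hy => ?_
    rw [dist_eq_norm, dist_eq_norm]
    have h1 : ‖B x - B y‖ ≤ 2 * M * C * ‖x - y‖ :=
      norm_sum_bump_smul_sub_le hC hφ0 hMI (fun i _ => hPn i) x y
    have h2 : |N x - N y| ≤ 2 * M * C * ‖x - y‖ := by
      have := norm_sum_bump_smul_sub_le (P := fun _ => (1 : ℝ)) hC hφ0 hMI (fun i _ => by simp) x y
      simpa [hN, Real.norm_eq_abs] using this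
    have := norm_inv_smul_sub_le (hN1 x hx) (hN1 y hy) h2 h1 (hBN y)
    push_cast
    linarith
  · have h1 : ∀ i, star (P i) = P i := fun i => isSelfAdjoint_starProjection _
    have h2 : star (B x) = B x := by
      have h3 : ∀ i ∈ I, star (φ (x - i) • P i) = φ (x - i) • P i := fun i _ => by
        rw [star_smul, star_trivial, h1]
      exact Finset.sum_induction _ (fun Q : Euc n →L[ℝ] Euc n => star Q = Q)
        (fun Q Q' hQ hQ' => (map_add ContinuousLinearMap.adjoint Q Q').trans (congrArg₂ _ hQ hQ'))
        (map_zero ContinuousLinearMap.adjoint) h3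
    rw [star_smul, star_trivial, h2]
  · have hN0 : 0 < N x := by linarith [hN1 x hx]
    have e : (N x)⁻¹ • B x - P x = (N x)⁻¹ • ∑ i ∈ I, φ (x - i) • (P i - P x) := by
      have h1 : ∑ i ∈ I, φ (x - i) • (P i - P x) = B x - N x • P x := by
        simp only [smul_sub, Finset.sum_sub_distrib, ← Finset.sum_smul, hB, hN]
      rw [h1, smul_sub, smul_smul, inv_mul_cancel₀ hN0.ne', one_smul]
    change ‖(N x)⁻¹ • B x - P x‖ ≤ η
    rw [e, norm_smul, Real.norm_of_nonneg (inv_nonneg.2 hN0.le)]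
    have h2 : ‖∑ i ∈ I, φ (x - i) • (P i - P x)‖ ≤ N x * η := by
      rw [hN, Finset.sum_mul]
      refine (norm_sum_le _ _).trans (Finset.sum_le_sum fun i hi => ?_)
      rw [norm_smul, Real.norm_of_nonneg φ.nonneg]
      rcases lt_or_ge ‖x - i‖ (2 * r) with hxi | hxi
      · refine mul_le_mul_of_nonneg_left ?_ φ.nonneg
        have h3 : ‖i - x‖ < 2 * r := by rwa [norm_sub_rev]
        refine (hS.norm_starProjection_orthogonal_sub_le hL hα hx (hIS hi)
          (by linarith)).trans (le_trans ?_ hrη)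
        gcongr
      · rw [hφ0 _ hxi, zero_mul, zero_mul]
    calc (N x)⁻¹ * _ ≤ (N x)⁻¹ * (N x * η) := by gcongr
      _ = η := by field_simp

/-- The submanifolds of the class have `ε`-normal maps with a common Lipschitz constant. -/
theorem exists_uniform_normalMap (m n : ℕ) {R L α ε : ℝ} (hR : 0 < R) (hL : 0 < L) (hα : 0 < α)
    (hε : 0 < ε) (hε1 : ε < 1) :
    ∃ Λ : ℝ≥0, 0 < Λ ∧ ∀ (d : ℝ) (S : Set (Euc n)), GraphPatchClass m n α R L d S →
      ∃ Φ : Euc n → Euc n →L[ℝ] Euc n, IsNormalMap m ε S Φ ∧ LipschitzOnWith Λ Φ S := by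
  obtain ⟨η, K, F, hη, hFP, hFA, hFL⟩ := exists_idempotent_retraction (Euc n →L[ℝ] Euc n)
    ContinuousLinearMap.norm_id_le
  -- The retraction fixes `P x` and is `K`-Lipschitz, so an `η'`-approximation becomes a `K *
  -- η'`-approximation; `K + 1` avoids a zero denominator.
  set η' := min η (ε / (K + 1)) with hη'
  have hη'0 : 0 < η' := lt_min hη (by positivity)
  have hη'ε : K * η' ≤ ε := by
    calc (K : ℝ) * η' ≤ (K + 1) * (ε / (K + 1)) := by
          gcongr
          · linarith
          · exact min_le_right _ _
      _ = ε := by field_simp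
  obtain ⟨Λ, hΛ⟩ := exists_uniform_mean m n hR hL hα hη'0
  refine ⟨K * Λ + 1, by positivity, fun d S hS => ?_⟩
  obtain ⟨A, hAC, hAL, hA⟩ := hΛ d S hS
  set P : Euc n → Euc n →L[ℝ] Euc n := fun x => (tangentPlane S x)ᗮ.starProjection with hP
  have hPP : ∀ x, P x * P x = P x := fun x => Submodule.isIdempotentElem_starProjection _
  have hPn : ∀ x, ‖P x‖ ≤ 1 := fun x => Submodule.starProjection_norm_le _
  have hAη : ∀ x ∈ S, ‖A x - P x‖ ≤ η := fun x hx => (hA x hx).2.trans (min_le_left _ _)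
  have hnear : ∀ x ∈ S, ‖F (A x) - P x‖ ≤ ε := by
    intro x hx
    have h1 := hFL (P x) (P x) (A x) (P x) (hPP x) (hPn x) (hPP x) (hPn x) (hAη x hx)
      (by rw [sub_self, norm_zero]; exact hη.le)
    rw [hFP _ (hPP x)] at h1
    refine h1.trans (le_trans ?_ hη'ε)
    gcongr
    exact (hA x hx).2
  have hlip : LipschitzOnWith (K * Λ + 1) (fun x => F (A x)) S := by
    refine LipschitzOnWith.of_dist_le_mul fun x hx y hy => ?_
    have h1 := hFL (P x) (P y) (A x) (A y) (hPP x) (hPn x) (hPP y) (hPn y) (hAη x hx) (hAη y hy)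
    have h2 := hAL.dist_le_mul x hx y hy
    rw [dist_eq_norm] at h2
    rw [dist_eq_norm]
    push_cast
    calc ‖F (A x) - F (A y)‖ ≤ K * (Λ * dist x y) := h1.trans (by gcongr)
      _ ≤ (K * Λ + 1) * dist x y := by nlinarith [dist_nonneg (x := x) (y := y)]
  refine ⟨fun x => F (A x), ⟨fun x hx => ?_, fun x hx => ?_, ⟨_, hlip⟩, hnear⟩, hlip⟩
  · obtain ⟨-, h1, h2⟩ := hFA (P x) (A x) (hPP x) (hPn x) (hAη x hx)
    refine ⟨h1, h2 (hA x hx).1, ?_⟩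
    rw [trace_eq_of_norm_sub_lt_one h1 ((hnear x hx).trans_lt hε1)]
    have h3 := (tangentPlane S x).finrank_add_finrank_orthogonal
    rw [hS.finrank_tangentPlane hx, finrank_euclideanSpace_fin] at h3
    have h4 : (m : ℝ) + Module.finrank ℝ (tangentPlane S x)ᗮ = n := by exact_mod_cast h3
    linarith
  · obtain ⟨h1, -, -⟩ := hFA (P x) (A x) (hPP x) (hPn x) (hAη x hx)
    exact h1.comp_contDiffWithinAt x (hAC x hx)

end

/-! ### The main theorem -/

theorem mainTheorem6 (m n : ℕ) (R L α : ℝ) (hR : 0 < R) (hL : 0 < L)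
    (hα : 0 < α) (hα1 : α ≤ 1) (ε : ℝ) (hε : 0 < ε) (hε1 : ε < 1 / 100) :
    -- for a given `ε`-normal map with Lipschitz constant `Λ`
    (∀ (d : ℝ) (S₁ S₂ : Set (Euc n)) (Φ : Euc n → Euc n →L[ℝ] Euc n) (Λ : ℝ≥0),
      0 < d → GraphPatchClass m n α R L d S₁ → GraphPatchClass m n α R L d S₂ →
      IsNormalMap m ε S₁ Φ → 0 < Λ → LipschitzOnWith Λ Φ S₁ →
      hausdorffSumDist S₁ S₂ < ENNReal.ofReal (rhoG R L α ε Λ) →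
      ∃ H : Euc n → ℝ → Euc n, IsC1AmbientIsotopy H S₁ S₂ ∧
        ContractsAlongFibres H (deltaTub R L α ε Λ) S₁ S₂ Φ) ∧
    -- with a threshold that depends only on `R, L, α, m, n` (and `ε`)
    (∃ Λ : ℝ≥0, 0 < Λ ∧ ∀ (d : ℝ) (S₁ S₂ : Set (Euc n)),
      0 < d → GraphPatchClass m n α R L d S₁ → GraphPatchClass m n α R L d S₂ →
      hausdorffSumDist S₁ S₂ < ENNReal.ofReal (rhoG R L α ε Λ) →
      ∃ Φ : Euc n → Euc n →L[ℝ] Euc n, IsNormalMap m ε S₁ Φ ∧ LipschitzOnWith Λ Φ S₁ ∧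
        ∃ H : Euc n → ℝ → Euc n, IsC1AmbientIsotopy H S₁ S₂ ∧
          ContractsAlongFibres H (deltaTub R L α ε Λ) S₁ S₂ Φ) := by

  refine ⟨fun d S₁ S₂ Φ Λ _ h₁ h₂ hΦ hΛ hlip hd => ?_, ?_⟩
  · exact (isCloseToTube_of_hausdorffSumDist_lt hR hL hα hα1 hε hε1 h₁ h₂ hΦ hΛ hlip
      hd).exists_isotopy
  · obtain ⟨Λ, hΛ, hex⟩ := exists_uniform_normalMap m n hR hL hα hε (by linarith)
    refine ⟨Λ, hΛ, fun d S₁ S₂ _ h₁ h₂ hd => ?_⟩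
    obtain ⟨Φ, hΦ, hlip⟩ := hex d S₁ h₁
    exact ⟨Φ, hΦ, hlip, (isCloseToTube_of_hausdorffSumDist_lt hR hL hα hα1 hε hε1 h₁ h₂ hΦ hΛ hlip
      hd).exists_isotopy⟩
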